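/- Let $M$ be an $m$-dimensional ($m\ge 1$) smooth manifold with possibly empty boundary, let $i:M\to\mathbb R^d$ be a smooth embedding, and equip $M$ with the Riemannian metric induced from $\mathbb R^d$; assume that $M$ is complete for its intrinsic distance $d_M$. Let $\rho\in[0,\infty]$ be the radius of curvature, $\rho=\inf 1/\|\ddot\gamma\|$, where the infimum is over all unit-speed length-minimizing curves $\gamma$ of $M$ and $\ddot\gamma$ is the acceleration of $i\circ\gamma$ in $\mathbb R^d$ (equivalently, $1/\rho$ is the supremum of the Lipschitz constants of the velocities of these curves), and assume $$\kappa:=\inf_{x\in M}\ \inf_{y\in M\setminus B_M(x,\pi\rho)}\|i(x)-i(y)\|>0\qquad(\inf\emptyset=+\infty).$$ Let $k:[0,\infty)\to[0,\infty)$ be measurable, non-increasing and $C^2$ on $(0,\infty)$, with $k,k',k''$ bounded and exponentially decaying, $k(0)=0$, and $k(t)=0$ for $t>R_k^2$, where $R_k>0$; put $k_h(t)=h^{-m}k(t/h^2)$ and $\|k\|_\infty=\sup_{t\ge0}k(t)$. Let $P=p\,dV$ be a probability measure on $M$, where $dV$ is the natural volume element, $p\in C^3(M)$ and $p>0$ on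 $M\setminus\partial M$. For a sample $X_1,\dots,X_n$ drawn i.i.d. from $P$, $n\ge1$, $h>0$ and $\lambda\in\mathbb R$, let $$d_{h,n}(y)=\frac1n\sum_{j=1}^n k_h(\|i(y)-i(X_j)\|^2),\qquad p_h(y)=\int_M k_h(\|i(y)-i(z)\|^2)\,dP(z),$$ $$(\tilde A_{\lambda,h,n}g)(x)=\frac1n\sum_{j=1}^n\frac{k_h(\|i(x)-i(X_j)\|^2)}{[d_{h,n}(x)\,d_{h,n}(X_j)]^\lambda}\,g(X_j),\qquad(\tilde A_{\lambda,h}g)(x)=\int_M\frac{k_h(\|i(x)-i(y)\|^2)}{[p_h(x)\,p_h(y)]^\lambda}\,g(y)\,dP(y),$$ and $\tilde d_{\lambda,h,n}=\tilde A_{\lambda,h,n}1$, $\tilde d_{\lambda,h}=\tilde A_{\lambda,h}1$. Fix $\lambda\in\mathbb R$, $x\in M\setminus\partial M$ and $f\in C^3(M)$, put $g(y)=f(x)-f(y)$, and fix a finite number $h_{\max}$ with $2R_kh_{\max}\le\kappa$ (if $\kappa<\infty$ one may take $h_{\max}=\kappa/(2R_k)$). Then there is a constant $C>0$, not depending on $n$,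 $h$, $\varepsilon$, such that for all $n\ge1$, all $0<h<h_{\max}$ and all $\varepsilon$ with $\frac{2\|k\|_\infty}{nh^m}<\varepsilon<\frac1C$, with probability at least $1-C\,n\,e^{-nh^m\varepsilon^2/C}$ both $$|(\tilde A_{\lambda,h,n}g)(x)-(\tilde A_{\lambda,h}g)(x)|\le\varepsilon h\qquad\text{and}\qquad|\tilde d_{\lambda,h,n}(x)-\tilde d_{\lambda,h}(x)|\le\varepsilon .$$ -/

import Mathlib

open MeasureTheory ProbabilityTheory Set Bundle
open scoped Manifold ContDiff ENNReal NNReal Bundle Topology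

noncomputable section

/-! ### Submanifolds: isometric embedding, radius of curvature, volume element -/

/-- `i : M → ℝ^d` is a smooth embedding and the Riemannian metric of `M` is the one induced
from `ℝ^d`. -/
structure IsIsometricEmbedding {m d : ℕ} {H : Type*} [TopologicalSpace H]
    (I : ModelWithCorners ℝ (EuclideanSpace ℝ (Fin m)) H)
    {M : Type*} [EMetricSpace M] [ChartedSpace H M] [IsManifold I ∞ M]
    [RiemannianBundle (fun x : M => TangentSpace I x)]
    (i : M → EuclideanSpace ℝ (Fin d)) : Prop where
  contMDiff : ContMDiff I 𝓘(ℝ, EuclideanSpace ℝ (Fin d)) ∞ i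
  isEmbedding : Topology.IsEmbedding i
  inner_eq : ∀ (x : M) (v w : TangentSpace I x),
    let Di : TangentSpace I x →L[ℝ] EuclideanSpace ℝ (Fin d) :=
      mfderiv I 𝓘(ℝ, EuclideanSpace ℝ (Fin d)) i x
    @inner ℝ (EuclideanSpace ℝ (Fin d)) _ (Di v) (Di w) = inner ℝ v w

/-- `γ` restricted to `[0, L]` is a length-minimizing curve parametrized by arc length. -/
def IsUnitSpeedMinimizing {M : Type*} [EMetricSpace M] (γ : ℝ → M) (L : ℝ) : Prop :=
  ∀ s ∈ Icc 0 L, ∀ t ∈ Icc 0 L, edist (γ s) (γ t) = ENNReal.ofReal |s - t|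

/-- Every unit-speed length-minimizing curve of `M`, seen as a curve `c` in `ℝ^d`, has
acceleration `‖c''‖ ≤ K`. Since a minimizing curve that runs partly along the boundary is in
general only of class `C^{1,1}`, so that `c''` exists only almost everywhere, the bound is
expressed by the Lipschitz constant of the velocity `c'` (for a `C^2` curve this is
`sup ‖c''‖`). -/
def HasAccelerationBound {d : ℕ} {M : Type*} [EMetricSpace M]
    (i : M → EuclideanSpace ℝ (Fin d)) (K : ℝ≥0) : Prop :=
  ∀ (γ : ℝ → M) (L : ℝ), IsUnitSpeedMinimizing γ L →
    ∃ v : ℝ → EuclideanSpace ℝ (Fin d),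
      (∀ t ∈ Ioo 0 L, HasDerivAt (fun s => i (γ s)) (v t) t) ∧ LipschitzOnWith K v (Ioo 0 L)

/-- The radius of curvature `ρ = inf 1 / ‖γ''‖ = 1 / sup ‖γ''‖ ∈ [0, ∞]`, over all unit-speed
length-minimizing curves `γ` of `M`. -/
def radiusOfCurvature {d : ℕ} {M : Type*} [EMetricSpace M]
    (i : M → EuclideanSpace ℝ (Fin d)) : ℝ≥0∞ :=
  (⨅ (K : ℝ≥0) (_ : HasAccelerationBound i K), (K : ℝ≥0∞))⁻¹

/-- `κ = inf_{x ∈ M} inf_{y ∈ M \ B_M(x, π ρ)} ‖i x - i y‖ ∈ [0, ∞]`. -/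
def kappa {d : ℕ} {M : Type*} [EMetricSpace M] (i : M → EuclideanSpace ℝ (Fin d)) : ℝ≥0∞ :=
  ⨅ (x : M) (y : M) (_ : ENNReal.ofReal Real.pi * radiusOfCurvature i ≤ edist x y),
    edist (i x) (i y)

/-- The matrix `g_{ab} = ⟨∂_a i, ∂_b i⟩` of the induced metric in the preferred chart at `x₀`,
at the coordinate point `y`. -/
def metricMatrix {m d : ℕ} {H : Type*} [TopologicalSpace H]
    (I : ModelWithCorners ℝ (EuclideanSpace ℝ (Fin m)) H)
    {M : Type*} [TopologicalSpace M] [ChartedSpace H M]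
    (i : M → EuclideanSpace ℝ (Fin d)) (x₀ : M) (y : EuclideanSpace ℝ (Fin m)) :
    Matrix (Fin m) (Fin m) ℝ :=
  let D : EuclideanSpace ℝ (Fin m) →L[ℝ] EuclideanSpace ℝ (Fin d) :=
    fderivWithin ℝ (fun z => i ((extChartAt I x₀).symm z)) (range I) y
  Matrix.of fun a b =>
    inner ℝ (D (EuclideanSpace.single a 1)) (D (EuclideanSpace.single b 1))

/-- `P = p dV`, where `dV = √(det g) dy` is the natural volume element of `M`: in the preferred
chart `φ` around any point, `P(A) = ∫_{φ(A)} p √(det g) dy` for each measurable subset `A` of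
the chart domain. -/
def HasVolumeDensity {m d : ℕ} {H : Type*} [TopologicalSpace H]
    (I : ModelWithCorners ℝ (EuclideanSpace ℝ (Fin m)) H)
    {M : Type*} [TopologicalSpace M] [ChartedSpace H M] [MeasurableSpace M]
    (i : M → EuclideanSpace ℝ (Fin d)) (P : Measure M) (p : M → ℝ) : Prop :=
  ∀ (x₀ : M) (A : Set M), MeasurableSet A → A ⊆ (chartAt H x₀).source →
    P A = ∫⁻ y in extChartAt I x₀ '' A,
      ENNReal.ofReal (p ((extChartAt I x₀).symm y) * √(metricMatrix I i x₀ y).det)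

/-! ### The kernel -/

/-- The standing assumptions on the kernel function `k : [0, ∞) → ℝ` (values of `k` at negative
arguments play no role). -/
structure IsAdmissibleKernel (k : ℝ → ℝ) : Prop where
  measurable : Measurable k
  nonneg : ∀ t, 0 ≤ t → 0 ≤ k t
  antitoneOn : AntitoneOn k (Ioi 0)
  contDiffOn : ContDiffOn ℝ 2 k (Ioi 0)
  bounded : ∃ B : ℝ, ∀ t, 0 < t → |k t| ≤ B ∧ |deriv k t| ≤ B ∧ |deriv (deriv k) t| ≤ B
  decay : ∃ c α A : ℝ, 0 < α ∧ ∀ t, 0 < t → A ≤ t →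
    max (k t) (max |deriv k t| |deriv (deriv k) t|) ≤ c * Real.exp (-α * t)
  zero : k 0 = 0

/-- `‖k‖_∞ = sup_{t ≥ 0} |k t|`. -/
def kernelSupNorm (k : ℝ → ℝ) : ℝ := ⨆ t : ℝ≥0, |k t|

/-- `k_h(t) = h^{-m} k(t / h^2)`. -/
def scaledKernel (k : ℝ → ℝ) (m : ℕ) (h t : ℝ) : ℝ := 1 / h ^ m * k (t / h ^ 2)

/-! ### Empirical and continuous averages -/

section Averages

variable {d : ℕ} {M : Type*}

/-- `d_{h,n}(y) = (1/n) ∑_j k_h(‖i y - i X_j‖²)` for the sample `X_1, …, X_n`. -/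
def empDegree (i : M → EuclideanSpace ℝ (Fin d)) (k : ℝ → ℝ) (m : ℕ) (h : ℝ)
    {n : ℕ} (X : Fin n → M) (y : M) : ℝ :=
  1 / (n : ℝ) * ∑ j, scaledKernel k m h (‖i y - i (X j)‖ ^ 2)

/-- The data-dependent kernel `k_h(‖i x - i y‖²) / [d_{h,n}(x) d_{h,n}(y)]^λ`. -/
def empReweightedKernel (i : M → EuclideanSpace ℝ (Fin d)) (k : ℝ → ℝ) (m : ℕ) (lam h : ℝ)
    {n : ℕ} (X : Fin n → M) (x y : M) : ℝ :=
  scaledKernel k m h (‖i x - i y‖ ^ 2) / (empDegree i k m h X x * empDegree i k m h X y) ^ lam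

/-- The empirical average operator `Ã_{λ,h,n}`. -/
def empAverage (i : M → EuclideanSpace ℝ (Fin d)) (k : ℝ → ℝ) (m : ℕ) (lam h : ℝ)
    {n : ℕ} (X : Fin n → M) (f : M → ℝ) (x : M) : ℝ :=
  1 / (n : ℝ) * ∑ j, empReweightedKernel i k m lam h X x (X j) * f (X j)

/-- The empirical degree function `d̃_{λ,h,n}`. -/
def empReweightedDegree (i : M → EuclideanSpace ℝ (Fin d)) (k : ℝ → ℝ) (m : ℕ) (lam h : ℝ)
    {n : ℕ} (X : Fin n → M) (x : M) : ℝ :=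
  1 / (n : ℝ) * ∑ j, empReweightedKernel i k m lam h X x (X j)

variable [MeasurableSpace M]

/-- `p_h(y) = 𝔼_Z k_h(‖i y - i Z‖²)`, `Z ∼ P`. -/
def smoothedDensity (i : M → EuclideanSpace ℝ (Fin d)) (k : ℝ → ℝ) (m : ℕ) (P : Measure M)
    (h : ℝ) (y : M) : ℝ :=
  ∫ z, scaledKernel k m h (‖i y - i z‖ ^ 2) ∂P

/-- The reweighted kernel `k_h(‖i x - i y‖²) / [p_h(x) p_h(y)]^λ`. -/
def reweightedKernel (i : M → EuclideanSpace ℝ (Fin d)) (k : ℝ → ℝ) (m : ℕ) (P : Measure M)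
    (lam h : ℝ) (x y : M) : ℝ :=
  scaledKernel k m h (‖i x - i y‖ ^ 2) /
    (smoothedDensity i k m P h x * smoothedDensity i k m P h y) ^ lam

/-- The continuous average operator `Ã_{λ,h}`, an integral against `P = p dV`. -/
def contAverage (i : M → EuclideanSpace ℝ (Fin d)) (k : ℝ → ℝ) (m : ℕ) (P : Measure M)
    (lam h : ℝ) (f : M → ℝ) (x : M) : ℝ :=
  ∫ y, reweightedKernel i k m P lam h x y * f y ∂P

/-- The continuous degree function `d̃_{λ,h} = Ã_{λ,h} 1`. -/
def contReweightedDegree (i : M → EuclideanSpace ℝ (Fin d)) (k : ℝ → ℝ) (m : ℕ)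
    (P : Measure M) (lam h : ℝ) (x : M) : ℝ :=
  contAverage i k m P lam h (fun _ => 1) x

end Averages

end

/-! Write `W y z` for the scaled kernel `k_h(‖i y - i z‖²)`. The proof needs only a few facts about
it, uniform in `0 < h < hmax` and recorded in `IsLocalKernel`: `W ≤ B / h ^ m`, the mean degrees
`p_h y` lie in a fixed interval `[c, D]` with `c > 0` for all `y` with `‖i x - i y‖ ≤ Rk * h`, and
on that set `|f x - f y| ≤ G * h`.

Given these, the theorem is Bernstein's inequality plus a union bound. A function dominated by `W x`
has second moment of order `D * B / h ^ m`, so its empirical mean deviates by `δ` with probability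
at most of order `exp(-n h^m δ² / const)`. This is applied to the degree at `x`, to the degrees at
the `n` sample points (conditionally on that point, whose own term vanishes because `k 0 = 0`), and
to the two averages weighted by the true `p_h`. Off the exceptional events, `s ↦ 1 / s ^ lam` is
Lipschitz on the range of the products of degrees, so empirical degrees may replace true ones at a
cost proportional to `δ` (`abs_reweighted_sub_le`, `measure_pi_not_le`). The factor `h` in the first
estimate is the bound `G * h` on `g`.

The uniform facts (`exists_isLocalKernel`) come from two regimes. For small `h`, a chart at the
interior point `x` compares the measure of extrinsic balls with `r ^ m`. For `h` bounded below, a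
finite net in `ℝ^d` bounds the degrees from below, and `f` must be bounded on `{y | ‖i x - i y‖ ≤ Rk
* hmax}`. Here completeness and `κ` enter: such `y` satisfy `d_M(x, y) < π ρ`. If `ρ < ∞`,
Hopf–Rinow makes the closed ball of radius `π ρ` compact; if `ρ = ∞`, minimizing curves are straight
in `ℝ^d`, so extrinsic distance controls intrinsic distance (`exists_isCompact_of_lt_kappa`). -/

/-- Points at finite distance are joined by curves that are almost minimizing and parametrized
almost by arc length. -/
def HasAlmostMinimizingCurves (M : Type*) [EMetricSpace M] : Prop :=
  ∀ (x y : M) (L : ℝ), 0 ≤ L → edist x y = ENNReal.ofReal L → ∀ ε : ℝ, 0 < ε →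
    ∃ c : ℝ → M, c 0 = x ∧ c L = y ∧
      ∀ s t, 0 ≤ s → s ≤ t → t ≤ L → edist (c s) (c t) ≤ ENNReal.ofReal (t - s + ε)

/-! ### Arc length and almost minimizing curves. -/

section RiemannianLength

variable {E : Type*} [NormedAddCommGroup E] [NormedSpace ℝ E]
  {H : Type*} [TopologicalSpace H] {I : ModelWithCorners ℝ E H}
  {M : Type*} [EMetricSpace M] [ChartedSpace H M]
  [RiemannianBundle (fun x : M => TangentSpace I x)]

/-- Absolute continuity of the integral of the speed. -/
theorem continuousOn_toReal_pathELength {γ : ℝ → M} {a b : ℝ}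
    (hfin : Manifold.pathELength I γ a b ≠ ⊤) :
    ContinuousOn (fun t => (Manifold.pathELength I γ a t).toReal) (Icc a b) := by
  have hle : ∀ t ∈ Icc a b, Manifold.pathELength I γ a t ≠ ⊤ := fun t ht =>
    ne_top_of_le_ne_top hfin (Manifold.pathELength_mono le_rfl ht.2)
  rw [Metric.continuousOn_iff]
  intro s hs ε hε
  have h1 : ∫⁻ t in Icc a b, ‖mfderiv 𝓘(ℝ, ℝ) I γ t 1‖ₑ ≠ ⊤ := by
    rwa [Manifold.pathELength_eq_lintegral_mfderiv_Icc] at hfin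
  obtain ⟨δ, hδ, hδ'⟩ := exists_pos_setLIntegral_lt_of_measure_lt h1
    (ε := ENNReal.ofReal ε) (by simpa using hε)
  have key : ∀ s ∈ Icc a b, ∀ t ∈ Icc a b, s ≤ t → ENNReal.ofReal (t - s) < δ →
      (Manifold.pathELength I γ a t).toReal < (Manifold.pathELength I γ a s).toReal + ε ∧
      (Manifold.pathELength I γ a s).toReal ≤ (Manifold.pathELength I γ a t).toReal := by
    intro s hs t ht hst hd
    have h2 := Manifold.pathELength_add (I := I) (γ := γ) hs.1 hst
    have h3 : Manifold.pathELength I γ s t < ENNReal.ofReal ε := by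
      have := hδ' (Icc s t) (by
        refine lt_of_le_of_lt (Measure.restrict_apply_le _ _) ?_
        rwa [Real.volume_Icc])
      rwa [Measure.restrict_restrict measurableSet_Icc,
        inter_eq_left.2 (Icc_subset_Icc hs.1 ht.2),
        ← Manifold.pathELength_eq_lintegral_mfderiv_Icc] at this
    rw [← h2, ENNReal.toReal_add (hle s hs) h3.ne_top]
    have h4 : (Manifold.pathELength I γ s t).toReal < ε := by
      rw [← ENNReal.lt_ofReal_iff_toReal_lt h3.ne_top]; exact h3
    have h5 : 0 ≤ (Manifold.pathELength I γ s t).toReal := ENNReal.toReal_nonneg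
    constructor <;> linarith
  obtain ⟨r, hr0, hr⟩ : ∃ r : ℝ, 0 < r ∧ ENNReal.ofReal r < δ := by
    obtain ⟨r, hr0, hr⟩ := ENNReal.lt_iff_exists_nnreal_btwn.1 hδ
    refine ⟨r, by exact_mod_cast hr0, by simpa using hr⟩
  refine ⟨r, hr0, fun t ht htr => ?_⟩
  rw [Real.dist_eq, abs_lt] at *
  rcases le_total s t with hst | hst
  · have := key s hs t ht hst
      ((ENNReal.ofReal_le_ofReal (by linarith)).trans_lt hr)
    constructor <;> linarith
  · have := key t ht s hs hst
      ((ENNReal.ofReal_le_ofReal (by linarith)).trans_lt hr)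
    constructor <;> linarith

/-- A `C^1` path of length less than `L + ε`, reparametrized by arc length: the intermediate value
theorem picks a time for each length, and no continuity of this choice is needed. -/
theorem hasAlmostMinimizingCurves_of_isRiemannianManifold [IsRiemannianManifold I M] :
    HasAlmostMinimizingCurves M := by
  intro x y L hL hxy ε hε
  have hlt : Manifold.riemannianEDist I x y < ENNReal.ofReal (L + ε) := by
    rw [← IsRiemannianManifold.out (I := I) x y, hxy]
    exact (ENNReal.ofReal_lt_ofReal_iff (by linarith)).2 (by linarith)
  obtain ⟨γ, h0, h1, hγ, hlen⟩ := Manifold.exists_lt_of_riemannianEDist_lt hlt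
  set ℓ : ℝ → ℝ := fun t => (Manifold.pathELength I γ 0 t).toReal with hℓ
  have hfin : ∀ t ≤ 1, Manifold.pathELength I γ 0 t ≠ ⊤ := fun t ht =>
    ne_top_of_le_ne_top hlen.ne_top (Manifold.pathELength_mono le_rfl ht)
  have hcont : ContinuousOn ℓ (Icc 0 1) := continuousOn_toReal_pathELength hlen.ne_top
  have hd : ∀ s t, 0 ≤ s → s ≤ t → t ≤ 1 → edist (γ s) (γ t) ≤ ENNReal.ofReal (ℓ t - ℓ s) := by
    intro s t hs hst ht
    rw [IsRiemannianManifold.out (I := I)]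
    refine (Manifold.riemannianEDist_le_pathELength
      (hγ.mono (Icc_subset_Icc hs ht)) rfl rfl hst).trans ?_
    have h2 := Manifold.pathELength_add (I := I) (γ := γ) hs hst
    have h3 : Manifold.pathELength I γ s t ≠ ⊤ :=
      ne_top_of_le_ne_top (hfin t ht) (Manifold.pathELength_mono hs le_rfl)
    have h4 : ℓ t - ℓ s = (Manifold.pathELength I γ s t).toReal := by
      simp only [hℓ]
      rw [← h2, ENNReal.toReal_add (hfin s (hst.trans ht)) h3]; ring
    rw [h4, ENNReal.ofReal_toReal h3]
  have hℓ0 : ℓ 0 = 0 := by simp [hℓ]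
  have hℓ1 : ℓ 1 < L + ε := by
    rw [hℓ, ← ENNReal.lt_ofReal_iff_toReal_lt hlen.ne_top]; exact hlen
  have hLℓ : L ≤ ℓ 1 := by
    have := hd 0 1 le_rfl zero_le_one le_rfl
    rw [h0, h1, hxy, hℓ0, sub_zero] at this
    exact (ENNReal.ofReal_le_ofReal_iff ENNReal.toReal_nonneg).1 this
  have hiv : ∀ s ∈ Icc 0 L, ∃ t ∈ Icc (0 : ℝ) 1, ℓ t = s := by
    intro s hs
    exact intermediate_value_Icc zero_le_one hcont ⟨by rw [hℓ0]; exact hs.1, hs.2.trans hLℓ⟩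
  choose! τ hτ hτs using hiv
  have hmono : ∀ s t, 0 ≤ s → s ≤ t → t ≤ 1 → ℓ s ≤ ℓ t := fun s t hs hst ht =>
    ENNReal.toReal_mono (hfin t ht) (Manifold.pathELength_mono le_rfl hst)
  rcases hL.eq_or_lt with rfl | hLpos
  · have hxy' : x = y := by simpa using hxy
    exact ⟨fun _ => x, rfl, hxy', fun s t hs hst ht => by simp⟩
  classical
  -- Both endpoints are hit exactly by force; at `L` the length may jump by less than `ε`, which is
  -- the only place where the slack is spent.
  set σ : ℝ → ℝ := fun s => if s = 0 then 0 else if s = L then 1 else τ s with hσ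
  have hσ01 : ∀ s ∈ Icc 0 L, σ s ∈ Icc (0 : ℝ) 1 := by
    intro s hs
    simp only [hσ]
    split_ifs
    · simp
    · simp
    · exact hτ s hs
  have hσℓ : ∀ s ∈ Icc 0 L, s ≤ ℓ (σ s) ∧ ℓ (σ s) < s + ε ∧ (s < L → ℓ (σ s) = s) := by
    intro s hs
    simp only [hσ]
    split_ifs with h h'
    · subst h
      exact ⟨hℓ0.ge, by rw [hℓ0]; linarith, fun _ => hℓ0⟩
    · subst h'
      exact ⟨hLℓ, hℓ1, fun h => absurd h (lt_irrefl _)⟩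
    · rw [hτs s hs]
      exact ⟨le_rfl, by linarith, fun _ => rfl⟩
  refine ⟨γ ∘ σ, by simp [hσ, h0], by simp [hσ, hLpos.ne', h1], fun s t hs hst ht => ?_⟩
  rcases hst.eq_or_lt with rfl | hst
  · simp
  have hs' : s ∈ Icc 0 L := ⟨hs, hst.le.trans ht⟩
  have ht' : t ∈ Icc 0 L := ⟨hs.trans hst.le, ht⟩
  obtain ⟨-, -, a3⟩ := hσℓ s hs'
  obtain ⟨b1, b2, -⟩ := hσℓ t ht'
  have a4 := a3 (hst.trans_le ht)
  have hle : σ s ≤ σ t := by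
    by_contra! hlt
    have := hmono _ _ (hσ01 t ht').1 hlt.le (hσ01 s hs').2
    linarith
  refine (hd _ _ (hσ01 s hs').1 hle (hσ01 t ht').2).trans (ENNReal.ofReal_le_ofReal ?_)
  linarith

end RiemannianLength

/-! ### Hopf–Rinow and existence of minimizing curves. -/

section HopfRinow

variable {M : Type*} [EMetricSpace M]

/-- Used to enlarge balls: on a curve with slack `δ / 2`, the point at parameter `r - 3 * δ / 2`
works; the remaining cases are those where `y` or `x` itself does. -/
theorem HasAlmostMinimizingCurves.exists_edist_le (hM : HasAlmostMinimizingCurves M) {x y : M}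
    {r δ : ℝ} (hδ : 0 < δ) (hr : δ ≤ r) (hxy : edist x y ≤ ENNReal.ofReal r) :
    ∃ z, edist x z ≤ ENNReal.ofReal (r - δ) ∧ edist z y ≤ ENNReal.ofReal (2 * δ) := by
  set L := (edist x y).toReal with hL
  have hL0 : 0 ≤ L := ENNReal.toReal_nonneg
  have hxyL : edist x y = ENNReal.ofReal L :=
    (ENNReal.ofReal_toReal (ne_top_of_le_ne_top ENNReal.ofReal_ne_top hxy)).symm
  have hLr : L ≤ r := by
    rw [hxyL] at hxy
    exact (ENNReal.ofReal_le_ofReal_iff (by linarith)).1 hxy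
  rcases le_or_gt L (r - δ) with h | h
  · exact ⟨y, by rw [hxyL]; exact ENNReal.ofReal_le_ofReal h, by simp⟩
  obtain ⟨c, h0, h1, hc⟩ := hM x y L hL0 hxyL (δ / 2) (by linarith)
  rcases le_or_gt (r - 3 * δ / 2) 0 with h' | h'
  · refine ⟨x, by simp, ?_⟩
    rw [hxyL]; exact ENNReal.ofReal_le_ofReal (by linarith)
  · refine ⟨c (r - 3 * δ / 2), ?_, ?_⟩
    · have := hc 0 (r - 3 * δ / 2) le_rfl h'.le (by linarith)
      rw [h0] at this
      exact this.trans (ENNReal.ofReal_le_ofReal (by linarith))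
    · have := hc (r - 3 * δ / 2) L h'.le (by linarith) le_rfl
      rw [h1] at this
      exact this.trans (ENNReal.ofReal_le_ofReal (by linarith))

/-- The Hopf–Rinow theorem: closed balls of a complete locally compact length space are compact. -/
theorem HasAlmostMinimizingCurves.isCompact_closedEBall [CompleteSpace M] [LocallyCompactSpace M]
    (hM : HasAlmostMinimizingCurves M) (x : M) (r : ℝ) :
    IsCompact (Metric.closedEBall x (ENNReal.ofReal r)) := by
  by_contra hr
  set S : Set ℝ := {s | IsCompact (Metric.closedEBall x (ENNReal.ofReal s))} with hS
  have hdown : ∀ s ∈ S, ∀ t ≤ s, t ∈ S := fun s hs t hts =>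
    IsCompact.of_isClosed_subset hs Metric.isClosed_closedEBall
      (Metric.closedEBall_subset_closedEBall (ENNReal.ofReal_le_ofReal hts))
  have h0 : (0 : ℝ) ∈ S := by
    have : Metric.closedEBall x (ENNReal.ofReal 0) = {x} := by
      ext y; simp
    simp only [hS, mem_ofPred_eq, this, isCompact_singleton]
  have hbdd : BddAbove S := ⟨r, fun s hs => by
    by_contra! h
    exact hr (hdown s hs r h.le)⟩
  set R := sSup S with hR
  have hR0 : 0 ≤ R := le_csSup hbdd h0
  have hlt : ∀ s < R, s ∈ S := fun s hs => by
    obtain ⟨t, ht, hst⟩ := exists_lt_of_lt_csSup ⟨0, h0⟩ hs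
    exact hdown t ht s hst.le
  -- The supremum is attained: a finite `δ`-net of the compact ball of radius `R - δ` is a `3δ`-net
  -- of the ball of radius `R`, and completeness does the rest.
  have hRS : R ∈ S := by
    rcases hR0.eq_or_lt with h | hRpos
    · rwa [← h]
    refine isCompact_iff_totallyBounded_isComplete.2 ⟨EMetric.totallyBounded_iff.2 fun ε hε => ?_,
      Metric.isClosed_closedEBall.isComplete⟩
    obtain ⟨e, he0, he⟩ : ∃ e : ℝ, 0 < e ∧ ENNReal.ofReal e < ε := by
      obtain ⟨r, hr0, hr⟩ := ENNReal.lt_iff_exists_nnreal_btwn.1 hε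
      exact ⟨r, by exact_mod_cast hr0, by simpa using hr⟩
    set δ := min (e / 3) R with hδ
    have hδ0 : 0 < δ := lt_min (by linarith) hRpos
    have hδe : δ ≤ e / 3 := min_le_left _ _
    obtain ⟨t, htf, ht⟩ := EMetric.totallyBounded_iff.1
      (IsCompact.totallyBounded (hlt (R - δ) (by linarith))) (ENNReal.ofReal δ) (by simpa using hδ0)
    refine ⟨t, htf, fun y hy => ?_⟩
    rw [Metric.mem_closedEBall, edist_comm] at hy
    obtain ⟨z, hz, hzy⟩ := hM.exists_edist_le hδ0 (min_le_right _ _) hy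
    have hz' := ht (show z ∈ Metric.closedEBall x (ENNReal.ofReal (R - δ)) by
      rwa [Metric.mem_closedEBall, edist_comm])
    simp only [mem_iUnion, Metric.mem_eball, exists_prop] at hz' ⊢
    obtain ⟨w, hw, hzw⟩ := hz'
    refine ⟨w, hw, lt_of_le_of_lt ?_ he⟩
    calc edist y w ≤ edist y z + edist z w := edist_triangle _ _ _
      _ ≤ ENNReal.ofReal (2 * δ) + ENNReal.ofReal δ :=
        add_le_add (by rwa [edist_comm]) hzw.le
      _ = ENNReal.ofReal (3 * δ) := by
        rw [← ENNReal.ofReal_add (by linarith) hδ0.le]; congr 1; ring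
      _ ≤ ENNReal.ofReal e := ENNReal.ofReal_le_ofReal (by linarith)
  -- Local compactness gives a compact thickening of the ball of radius `R`, which contains the ball
  -- of radius `R + δ / 2` and contradicts the choice of `R`.
  obtain ⟨K', hK', hKK'⟩ := exists_compact_superset (show IsCompact _ from hRS)
  obtain ⟨δ, hδ0, hδ⟩ := IsCompact.exists_cthickening_subset_open (show IsCompact _ from hRS)
    isOpen_interior hKK'
  have hmem : R + δ / 2 ∈ S := by
    refine hK'.of_isClosed_subset Metric.isClosed_closedEBall fun y hy => interior_subset (hδ ?_)
    rw [Metric.mem_closedEBall, edist_comm] at hy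
    obtain ⟨z, hz, hzy⟩ := hM.exists_edist_le (by linarith : 0 < δ / 2) (by linarith) hy
    refine Metric.mem_cthickening_of_edist_le y z δ _ ?_ ?_
    · rw [Metric.mem_closedEBall, edist_comm]
      exact hz.trans (ENNReal.ofReal_le_ofReal (by linarith))
    · rw [edist_comm]
      exact hzy.trans (ENNReal.ofReal_le_ofReal (by linarith))
  have := le_csSup hbdd hmem
  linarith

/-- In a complete locally compact length space, points at finite distance are joined by
length-minimizing curves. -/
theorem HasAlmostMinimizingCurves.exists_isUnitSpeedMinimizing [CompleteSpace M]
    [LocallyCompactSpace M] (hM : HasAlmostMinimizingCurves M) (x y : M) {L : ℝ} (hL : 0 ≤ L)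
    (hxy : edist x y = ENNReal.ofReal L) :
    ∃ γ : ℝ → M, IsUnitSpeedMinimizing γ L ∧ γ 0 = x ∧ γ L = y := by
  set e : ℕ → ℝ := fun n => 1 / ((n : ℝ) + 1) with he
  have he0 : ∀ n, 0 < e n := fun n => by positivity
  -- Nested sets of almost minimizers, closed for pointwise convergence. Confinement to a compact
  -- ball makes them compact by Tychonoff, so a point of the intersection replaces an Arzelà–Ascoli
  -- limit.
  set F : ℕ → Set (ℝ → M) := fun n =>
    {c | (∀ s, c s ∈ Metric.closedEBall x (ENNReal.ofReal (L + 1))) ∧ c 0 = x ∧ c L = y ∧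
      ∀ s t, 0 ≤ s → s ≤ t → t ≤ L → edist (c s) (c t) ≤ ENNReal.ofReal (t - s + e n)} with hF
  have hclosed : ∀ n, IsClosed (F n) := by
    intro n
    simp only [hF, ofPred_and, ofPred_forall]
    refine IsClosed.inter ?_ (IsClosed.inter ?_ (IsClosed.inter ?_ ?_))
    · exact isClosed_iInter fun s => Metric.isClosed_closedEBall.preimage (continuous_apply s)
    · exact isClosed_eq (continuous_apply _) continuous_const
    · exact isClosed_eq (continuous_apply _) continuous_const
    · refine isClosed_iInter fun s => isClosed_iInter fun t => isClosed_iInter fun _ =>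
        isClosed_iInter fun _ => isClosed_iInter fun _ => ?_
      exact isClosed_le ((continuous_apply s).edist (continuous_apply t)) continuous_const
  have hcpt : IsCompact (F 0) := by
    refine (isCompact_univ_pi fun _ : ℝ => hM.isCompact_closedEBall x (L + 1)).of_isClosed_subset
      (hclosed 0) fun c hc => ?_
    exact mem_univ_pi.2 hc.1
  have hne : ∀ n, (F n).Nonempty := by
    intro n
    obtain ⟨c, h0, h1, hc⟩ := hM x y L hL hxy (e n) (he0 n)
    have hclip : ∀ s, max 0 (min s L) ∈ Icc 0 L := fun s =>
      ⟨le_max_left _ _, max_le hL (min_le_right _ _)⟩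
    refine ⟨fun s => c (max 0 (min s L)), fun s => ?_, ?_, ?_, ?_⟩
    · rw [Metric.mem_closedEBall, edist_comm]
      have := hc 0 _ le_rfl (hclip s).1 (hclip s).2
      rw [h0] at this
      refine this.trans (ENNReal.ofReal_le_ofReal ?_)
      have h3 : e n ≤ 1 := by
        rw [he]; exact div_le_one_of_le₀ (by simp) (by positivity)
      linarith [(hclip s).2]
    · simp [hL, h0]
    · simp [hL, h1]
    · intro s t hs hst ht
      simp only [min_eq_left ht, min_eq_left (hst.trans ht), max_eq_right hs,
        max_eq_right (hs.trans hst)]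
      exact hc s t hs hst ht
  obtain ⟨γ, hγ⟩ := IsCompact.nonempty_iInter_of_sequence_nonempty_isCompact_isClosed F
    (fun n c hc => ⟨hc.1, hc.2.1, hc.2.2.1, fun s t hs hst ht =>
      (hc.2.2.2 s t hs hst ht).trans (ENNReal.ofReal_le_ofReal (by
        have : e (n + 1) ≤ e n := by
          simp only [he]; push_cast
          exact one_div_le_one_div_of_le (by positivity) (by linarith)
        linarith))⟩) hne hcpt hclosed
  rw [mem_iInter] at hγ
  have h0 := (hγ 0).2.1
  have h1 := (hγ 0).2.2.1
  have hle : ∀ s t, 0 ≤ s → s ≤ t → t ≤ L → edist (γ s) (γ t) ≤ ENNReal.ofReal (t - s) := by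
    intro s t hs hst ht
    have hlim : Filter.Tendsto (fun n => ENNReal.ofReal (t - s + e n)) Filter.atTop
        (𝓝 (ENNReal.ofReal (t - s + 0))) :=
      (ENNReal.continuous_ofReal.tendsto _).comp
        (tendsto_const_nhds.add tendsto_one_div_add_atTop_nhds_zero_nat)
    rw [add_zero] at hlim
    exact ge_of_tendsto' hlim fun n => (hγ n).2.2.2 s t hs hst ht
  have heq : ∀ s t, 0 ≤ s → s ≤ t → t ≤ L → edist (γ s) (γ t) = ENNReal.ofReal (t - s) := by
    intro s t hs hst ht
    -- The three pieces of the curve must add up to at least `L`, so none is shorter than its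
    -- parameter interval.
    refine le_antisymm (hle s t hs hst ht) ?_
    have hA := hle 0 s le_rfl hs (hst.trans ht)
    have hB := hle t L (hs.trans hst) ht le_rfl
    rw [h0, sub_zero] at hA
    rw [h1] at hB
    have hC : ENNReal.ofReal L ≤ ENNReal.ofReal s + edist (γ s) (γ t) + ENNReal.ofReal (L - t) := by
      rw [← hxy]
      calc edist x y ≤ edist x (γ s) + edist (γ s) (γ t) + edist (γ t) y := edist_triangle4 _ _ _ _
        _ ≤ _ := by gcongr
    have hfin : edist (γ s) (γ t) ≠ ⊤ := ne_top_of_le_ne_top ENNReal.ofReal_ne_top (hle s t hs hst ht)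
    rw [← ENNReal.ofReal_toReal hfin, ← ENNReal.ofReal_add hs ENNReal.toReal_nonneg,
      ← ENNReal.ofReal_add (add_nonneg hs ENNReal.toReal_nonneg) (by linarith),
      ENNReal.ofReal_le_ofReal_iff (by
        have : 0 ≤ (edist (γ s) (γ t)).toReal := ENNReal.toReal_nonneg
        linarith)] at hC
    rw [← ENNReal.ofReal_toReal hfin]
    exact ENNReal.ofReal_le_ofReal (by linarith)
  refine ⟨γ, fun s hs t ht => ?_, h0, h1⟩
  rcases le_total s t with h | h
  · rw [heq s t hs.1 h ht.2, abs_sub_comm, abs_of_nonneg (by linarith)]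
  · rw [edist_comm, heq t s ht.1 h hs.2, abs_of_nonneg (by linarith)]

end HopfRinow

/-! ### Radius of curvature and compactness below `κ`. -/

section RadiusOfCurvature

variable {d : ℕ} {M : Type*} [EMetricSpace M] {i : M → EuclideanSpace ℝ (Fin d)}

theorem IsUnitSpeedMinimizing.continuousOn {γ : ℝ → M} {L : ℝ} (hγ : IsUnitSpeedMinimizing γ L) :
    ContinuousOn γ (Icc 0 L) := by
  refine LipschitzOnWith.continuousOn (K := 1) fun s hs t ht => ?_
  rw [hγ s hs t ht, edist_dist s t, Real.dist_eq]
  simp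

/-- If the radius of curvature is infinite, minimizing curves are straight lines of `ℝ^d`. -/
theorem IsUnitSpeedMinimizing.eq_add_smul (hi : Continuous i)
    (hacc : ∀ K : ℝ≥0, 0 < K → ∃ K' < K, HasAccelerationBound i K')
    {γ : ℝ → M} {L : ℝ} (hL : 0 < L) (hγ : IsUnitSpeedMinimizing γ L) :
    ∃ v : EuclideanSpace ℝ (Fin d), ∀ t ∈ Icc 0 L, i (γ t) = i (γ 0) + t • v := by
  set w : ℝ → EuclideanSpace ℝ (Fin d) := deriv fun s => i (γ s) with hw
  have hderiv : ∀ t ∈ Ioo 0 L, HasDerivAt (fun s => i (γ s)) (w t) t := by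
    obtain ⟨K, -, hK⟩ := hacc 1 one_pos
    obtain ⟨v, hv, -⟩ := hK γ L hγ
    exact fun t ht => (hv t ht).differentiableAt.hasDerivAt
  have hconst : ∀ s ∈ Ioo 0 L, ∀ t ∈ Ioo 0 L, w s = w t := by
    intro s hs t ht
    -- The velocity is unique, so every acceleration bound applies to the same `w`; bounds tending
    -- to `0` make it constant.
    have key : ∀ ε : ℝ≥0, 0 < ε → dist (w s) (w t) ≤ ε * dist s t := by
      intro ε hε
      obtain ⟨K, hKε, hK⟩ := hacc ε hε
      obtain ⟨v, hv, hlip⟩ := hK γ L hγ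
      rw [(hderiv s hs).unique (hv s hs), (hderiv t ht).unique (hv t ht)]
      refine (hlip.dist_le_mul s hs t ht).trans ?_
      gcongr
    have h0 : dist (w s) (w t) ≤ 0 := by
      refine le_of_forall_pos_le_add fun e he => ?_
      have hd : 0 < dist s t + 1 := by positivity
      have := key (Real.toNNReal (e / (dist s t + 1))) (Real.toNNReal_pos.2 (div_pos he hd))
      refine this.trans ?_
      rw [Real.coe_toNNReal _ (div_pos he hd).le, div_mul_eq_mul_div, div_le_iff₀ hd]
      nlinarith [dist_nonneg (x := s) (y := t)]
    exact dist_le_zero.1 h0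
  have hmid : L / 2 ∈ Ioo 0 L := ⟨by linarith, by linarith⟩
  set v := w (L / 2) with hv
  set u : ℝ → EuclideanSpace ℝ (Fin d) := fun t => i (γ t) - t • v with hu
  have hucont : ContinuousOn u (Icc 0 L) :=
    (hi.comp_continuousOn hγ.continuousOn).sub (by fun_prop)
  have huderiv : ∀ t ∈ Ioo 0 L, HasDerivWithinAt u 0 (Ioo 0 L) t := by
    intro t ht
    have h1 := (hderiv t ht).sub ((hasDerivAt_id t).smul_const v)
    rw [hconst t ht _ hmid, one_smul, sub_self] at h1
    exact h1.hasDerivWithinAt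
  have hueq : EqOn u (fun _ => u (L / 2)) (Ioo 0 L) := by
    intro t ht
    have := (convex_Ioo (0 : ℝ) L).norm_image_sub_le_of_norm_hasDerivWithin_le (C := 0)
      huderiv (fun _ _ => by simp) hmid ht
    rw [zero_mul] at this
    exact sub_eq_zero.1 (norm_le_zero_iff.1 this)
  have hueq' : EqOn u (fun _ => u (L / 2)) (Icc 0 L) :=
    hueq.of_subset_closure hucont continuousOn_const Ioo_subset_Icc_self
      (by rw [closure_Ioo hL.ne])
  refine ⟨v, fun t ht => ?_⟩
  have h1 := (hueq' ht).trans (hueq' (left_mem_Icc.2 hL.le)).symm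
  simp only [hu, zero_smul, sub_zero] at h1
  rw [← h1]; abel

/-- Being extrinsically closer than `κ` forces `edist x y < π ρ`. For finite `ρ` this already
confines `y` to a compact ball. For infinite `ρ` it says only that the distance is finite; then `x`
and `y` are joined by a straight segment in `ℝ^d`, whose speed is controlled near `x` by `hloc`. -/
theorem exists_isCompact_of_lt_kappa [CompleteSpace M] [LocallyCompactSpace M]
    (hM : HasAlmostMinimizingCurves M) (hi : Continuous i) {x : M}
    {C : ℝ≥0} (hloc : ∀ᶠ z in 𝓝 x, edist x z ≤ C * edist (i x) (i z))
    {R : ℝ} (hR : ENNReal.ofReal R < kappa i) :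
    ∃ K : Set M, IsCompact K ∧ ∀ y, ‖i x - i y‖ ≤ R → y ∈ K := by
  have hlt : ∀ y, ‖i x - i y‖ ≤ R →
      edist x y < ENNReal.ofReal Real.pi * radiusOfCurvature i := by
    intro y hy
    by_contra! h
    have h1 : kappa i ≤ edist (i x) (i y) :=
      iInf_le_of_le x (iInf_le_of_le y (iInf_le_of_le h le_rfl))
    rw [edist_dist, dist_eq_norm] at h1
    exact absurd (h1.trans (ENNReal.ofReal_le_ofReal hy)) (not_le.2 hR)
  rcases eq_or_ne (radiusOfCurvature i) ⊤ with hρ | hρ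
  · have hacc : ∀ K : ℝ≥0, 0 < K → ∃ K' < K, HasAccelerationBound i K' := by
      intro K hK
      have h0 : (⨅ (K : ℝ≥0) (_ : HasAccelerationBound i K), (K : ℝ≥0∞)) < K := by
        rw [ENNReal.inv_eq_top.1 hρ]; exact_mod_cast hK
      simp only [iInf_lt_iff] at h0
      obtain ⟨K', hK', hlt⟩ := h0
      exact ⟨K', by exact_mod_cast hlt, hK'⟩
    refine ⟨_, hM.isCompact_closedEBall x (C * R), fun y hy => ?_⟩
    have hfin : edist x y ≠ ⊤ := ((hlt y hy).trans_le le_top).ne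
    set L := (edist x y).toReal with hL
    have hxy : edist x y = ENNReal.ofReal L := (ENNReal.ofReal_toReal hfin).symm
    rw [Metric.mem_closedEBall, edist_comm, hxy]
    refine ENNReal.ofReal_le_ofReal ?_
    have hLnn : 0 ≤ L := ENNReal.toReal_nonneg
    rcases hLnn.eq_or_lt with hL0 | hL0
    · rw [← hL0]
      exact mul_nonneg C.coe_nonneg ((norm_nonneg _).trans hy)
    obtain ⟨γ, hγ, h0, h1⟩ := hM.exists_isUnitSpeedMinimizing x y hL0.le hxy
    obtain ⟨v, hv⟩ := hγ.eq_add_smul hi hacc hL0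
    have hnorm : ∀ t ∈ Icc 0 L, ‖i x - i (γ t)‖ = t * ‖v‖ := by
      intro t ht
      rw [hv t ht, h0, sub_add_cancel_left, norm_neg, norm_smul, Real.norm_of_nonneg ht.1]
    obtain ⟨δ, hδ0, hδ⟩ := EMetric.mem_nhds_iff.1 hloc
    obtain ⟨e, he0, he⟩ : ∃ e : ℝ, 0 < e ∧ ENNReal.ofReal e < δ := by
      obtain ⟨r, hr0, hr⟩ := ENNReal.lt_iff_exists_nnreal_btwn.1 hδ0
      exact ⟨r, by exact_mod_cast hr0, by simpa using hr⟩
    set t := min e L with ht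
    have ht0 : 0 < t := lt_min he0 hL0
    have htL : t ∈ Icc 0 L := ⟨ht0.le, min_le_right _ _⟩
    have hxt : edist x (γ t) = ENNReal.ofReal t := by
      rw [← h0, hγ 0 (left_mem_Icc.2 hL0.le) t htL, zero_sub, abs_neg, abs_of_pos ht0]
    have h2 := hδ (show γ t ∈ Metric.eball x δ by
      rw [Metric.mem_eball, edist_comm, hxt]
      exact (ENNReal.ofReal_le_ofReal (min_le_left _ _)).trans_lt he)
    -- The local comparison at one small time bounds the speed below by `1 / C`; linearity carries
    -- this to time `L`, so `L ≤ C * R`.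
    have h3 : t ≤ C * (t * ‖v‖) := by
      have h2' : edist x (γ t) ≤ C * edist (i x) (i (γ t)) := h2
      rw [hxt, edist_dist, dist_eq_norm, hnorm t htL, ← ENNReal.ofReal_coe_nnreal,
        ← ENNReal.ofReal_mul C.coe_nonneg, ENNReal.ofReal_le_ofReal_iff (by positivity)] at h2'
      exact h2'
    have h4 : 1 ≤ C * ‖v‖ := by
      by_contra! h
      nlinarith
    have h5 := hnorm L (right_mem_Icc.2 hL0.le)
    rw [h1] at h5
    rw [h5] at hy
    have hC : (0 : ℝ) ≤ C := C.coe_nonneg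
    nlinarith
  · refine ⟨_, hM.isCompact_closedEBall x
      (ENNReal.ofReal Real.pi * radiusOfCurvature i).toReal, fun y hy => ?_⟩
    rw [Metric.mem_closedEBall, edist_comm,
      ENNReal.ofReal_toReal (ENNReal.mul_ne_top ENNReal.ofReal_ne_top hρ)]
    exact (hlt y hy).le

end RadiusOfCurvature

/-! ### Charts at interior points. -/

section LocalChart

variable {m d : ℕ}
  {H : Type*} [TopologicalSpace H]
  {I : ModelWithCorners ℝ (EuclideanSpace ℝ (Fin m)) H}
  {M : Type*} [EMetricSpace M] [ChartedSpace H M] [IsManifold I ∞ M]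
  [RiemannianBundle (fun x : M => TangentSpace I x)]
  {i : M → EuclideanSpace ℝ (Fin d)}

omit [IsManifold I ∞ M] [RiemannianBundle (fun x : M => TangentSpace I x)] in
theorem extChartAt_target_mem_nhds_of_mem_interior {x : M} (hx : x ∈ I.interior M) :
    (extChartAt I x).target ∈ 𝓝 (extChartAt I x x) := by
  have h1 : range I ∈ 𝓝 (extChartAt I x x) := range_mem_nhds_isInteriorPoint hx
  have h2 := extChartAt_target_mem_nhdsWithin (I := I) x
  rwa [nhdsWithin_eq_nhds.2 h1] at h2

omit [RiemannianBundle (fun x : M => TangentSpace I x)] in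
theorem contDiffAt_comp_extChartAt_symm {F : Type*} [NormedAddCommGroup F] [NormedSpace ℝ F]
    {n : ℕ∞} {g : M → F} (hg : ContMDiff I 𝓘(ℝ, F) n g) {x : M} (hx : x ∈ I.interior M) :
    ContDiffAt ℝ n (g ∘ (extChartAt I x).symm) (extChartAt I x x) := by
  have : IsManifold I n M := IsManifold.of_le (n := ∞) (by exact_mod_cast le_top)
  have h1 := hg.comp_contMDiffOn (contMDiffOn_extChartAt_symm (I := I) (n := n) x)
  exact (contMDiffOn_iff_contDiffOn.1 h1).contDiffAt
    (extChartAt_target_mem_nhds_of_mem_interior hx)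

/-- The differential preserves the inner product, hence kills no nonzero vector; at an interior
point it is a full derivative in the chart. -/
theorem IsIsometricEmbedding.injective_fderiv (hi : IsIsometricEmbedding I i) {x : M}
    (hx : x ∈ I.interior M) :
    Function.Injective (fderiv ℝ (i ∘ (extChartAt I x).symm) (extChartAt I x x)) := by
  have hd : MDifferentiableAt I 𝓘(ℝ, EuclideanSpace ℝ (Fin d)) i x :=
    hi.contMDiff.mdifferentiableAt (by simp)
  have h1 : mfderiv I 𝓘(ℝ, EuclideanSpace ℝ (Fin d)) i x =
      fderiv ℝ (i ∘ (extChartAt I x).symm) (extChartAt I x x) := by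
    refine hd.mfderiv.trans ?_
    exact fderivWithin_of_mem_nhds (range_mem_nhds_isInteriorPoint hx)
  have key : ∀ v : TangentSpace I x,
      mfderiv I 𝓘(ℝ, EuclideanSpace ℝ (Fin d)) i x v = 0 → v = 0 := by
    intro v hv
    have h2 := hi.inner_eq x v v
    have h3 : ∀ w : EuclideanSpace ℝ (Fin d), w = 0 → inner ℝ w w = (0 : ℝ) := fun w hw => by
      rw [hw, inner_zero_left]
    exact inner_self_eq_zero.1 (h2.symm.trans (h3 _ hv))
  refine (injective_iff_map_eq_zero _).2 fun v hv => key v ?_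
  rw [h1]
  exact hv

/-- The Lebesgue density of `p dV` in a chart. -/
noncomputable def chartDensity (I : ModelWithCorners ℝ (EuclideanSpace ℝ (Fin m)) H)
    (i : M → EuclideanSpace ℝ (Fin d)) (p : M → ℝ) (x : M) (u : EuclideanSpace ℝ (Fin m)) : ℝ :=
  p ((extChartAt I x).symm u) * √(metricMatrix I i x u).det

theorem IsIsometricEmbedding.continuousAt_chartDensity (hi : IsIsometricEmbedding I i)
    {p : M → ℝ} (hp : ContMDiff I 𝓘(ℝ, ℝ) 3 p) {x : M} (hx : x ∈ I.interior M) :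
    ContinuousAt (chartDensity I i p x) (extChartAt I x x) := by
  have hpc : ContinuousAt (p ∘ (extChartAt I x).symm) (extChartAt I x x) :=
    (contDiffAt_comp_extChartAt_symm (n := 3) hp hx).continuousAt
  have hF := contDiffAt_comp_extChartAt_symm (n := ⊤) hi.contMDiff hx
  have hD : ContinuousAt (fderiv ℝ (i ∘ (extChartAt I x).symm)) (extChartAt I x x) :=
    (hF.fderiv_right (m := 0) (by simp)).continuousAt
  have hD' : ContinuousAt (fun u => fderivWithin ℝ (i ∘ (extChartAt I x).symm) (range I) u)
      (extChartAt I x x) := by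
    refine hD.congr ?_
    have h1 : range I ∈ 𝓝 (extChartAt I x x) := range_mem_nhds_isInteriorPoint hx
    filter_upwards [eventually_mem_nhds_iff.2 h1] with u hu
    rw [fderivWithin_of_mem_nhds hu]
  have hmat : ContinuousAt (metricMatrix I i x) (extChartAt I x x) := by
    refine continuousAt_pi.2 fun a => continuousAt_pi.2 fun b => ?_
    exact ContinuousAt.inner (𝕜 := ℝ) (hD'.clm_apply continuousAt_const) (hD'.clm_apply continuousAt_const)
  have hdet : ContinuousAt (fun u => (metricMatrix I i x u).det) (extChartAt I x x) :=
    (Continuous.matrix_det continuous_id).continuousAt.comp hmat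
  exact hpc.mul (Real.continuous_sqrt.continuousAt.comp hdet)

/-- The metric matrix is the Gram matrix of the images of the basis vectors, which are independent
by `injective_fderiv`. -/
theorem IsIsometricEmbedding.chartDensity_pos (hi : IsIsometricEmbedding I i)
    {p : M → ℝ} {x : M} (hx : x ∈ I.interior M) (hpx : 0 < p x) :
    0 < chartDensity I i p x (extChartAt I x x) := by
  refine mul_pos (by rwa [extChartAt_to_inv]) (Real.sqrt_pos.2 ?_)
  have h1 : metricMatrix I i x (extChartAt I x x) =
      Matrix.gram ℝ (fun a => fderiv ℝ (i ∘ (extChartAt I x).symm) (extChartAt I x x)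
        (EuclideanSpace.single a 1)) := by
    ext a b
    simp only [metricMatrix, Matrix.of_apply, Matrix.gram_apply]
    rw [fderivWithin_of_mem_nhds (range_mem_nhds_isInteriorPoint hx)]
    rfl
  rw [h1]
  refine (Matrix.posDef_gram_of_linearIndependent ?_).det_pos
  have hb : LinearIndependent ℝ (fun a : Fin m => EuclideanSpace.single a (1 : ℝ)) := by
    have := (EuclideanSpace.basisFun (Fin m) ℝ).toBasis.linearIndependent
    convert! this with a
    simp
  exact hb.map' (fderiv ℝ (i ∘ (extChartAt I x).symm) (extChartAt I x x)).toLinearMap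
    (LinearMap.ker_eq_bot.2 (hi.injective_fderiv hx))

/-- A `C^1` map with injective derivative is locally bi-Lipschitz. -/
theorem HasStrictFDerivAt.exists_bilipschitz {E F : Type*} [NormedAddCommGroup E] [NormedSpace ℝ E]
    [FiniteDimensional ℝ E] [NormedAddCommGroup F] [NormedSpace ℝ F] {f : E → F} {D : E →L[ℝ] F}
    {u₀ : E} (hf : HasStrictFDerivAt f D u₀) (hD : Function.Injective D) :
    ∃ L > 0, ∃ a > 0, ∃ r > 0, ∀ u ∈ Metric.ball u₀ r, ∀ v ∈ Metric.ball u₀ r,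
      ‖f u - f v‖ ≤ L * ‖u - v‖ ∧ ‖u - v‖ ≤ a * ‖f u - f v‖ := by
  obtain ⟨K, hK0, hK⟩ := D.toLinearMap.exists_antilipschitzWith (LinearMap.ker_eq_bot.2 hD)
  have hKr : (0 : ℝ) < K := hK0
  have hanti : ∀ w, ‖w‖ ≤ K * ‖D w‖ := fun w => by
    have := hK.le_mul_dist w 0
    simpa using this
  -- Half of the expansion constant `1 / K` of `D`: the linearization error consumes half of the
  -- lower bound, leaving the factor `2 * K`.
  have hc : (0 : ℝ) < 1 / (2 * K) := by positivity
  have hev := hf.isLittleO.def hc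
  rw [nhds_prod_eq] at hev
  obtain ⟨t, ht, htr⟩ := Filter.mem_prod_self_iff.1 hev
  obtain ⟨r, hr0, hrt⟩ := Metric.mem_nhds_iff.1 ht
  refine ⟨‖D‖ + 1 / (2 * K), by positivity, 2 * K, by positivity, r, hr0, fun u hu v hv => ?_⟩
  have h1 : ‖f u - f v - D (u - v)‖ ≤ 1 / (2 * K) * ‖u - v‖ := htr (mk_mem_prod (hrt hu) (hrt hv))
  have h2 := D.le_opNorm (u - v)
  have h3 := hanti (u - v)
  have h4 := norm_sub_norm_le (f u - f v) (D (u - v))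
  have h5 := norm_sub_norm_le (D (u - v)) (f u - f v)
  rw [norm_sub_rev (D (u - v))] at h5
  have h6 : K * (1 / (2 * K) * ‖u - v‖) = ‖u - v‖ / 2 := by field_simp
  constructor
  · linarith
  · have h7 : K * ‖D (u - v)‖ ≤ K * (‖f u - f v‖ + 1 / (2 * K) * ‖u - v‖) := by
      gcongr; linarith
    nlinarith

/-- Around an interior point there is a chart ball on which the embedding is bi-Lipschitz, a given
`C^3` function is Lipschitz, and the density of `p dV` is bounded above and away from zero. -/
theorem IsIsometricEmbedding.exists_chart_ball (hi : IsIsometricEmbedding I i)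
    {p : M → ℝ} (hp : ContMDiff I 𝓘(ℝ, ℝ) 3 p) {f : M → ℝ} (hf : ContMDiff I 𝓘(ℝ, ℝ) 3 f)
    {x : M} (hx : x ∈ I.interior M) (hpx : 0 < p x) :
    ∃ L > 0, ∃ a > 0, ∃ q₀ > 0, ∃ q₁ > 0, ∃ G > 0, ∃ r > 0,
      Metric.ball (extChartAt I x x) r ⊆ (extChartAt I x).target ∧
      (∀ u ∈ Metric.ball (extChartAt I x x) r, ∀ v ∈ Metric.ball (extChartAt I x x) r,
        ‖i ((extChartAt I x).symm u) - i ((extChartAt I x).symm v)‖ ≤ L * ‖u - v‖ ∧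
        ‖u - v‖ ≤ a * ‖i ((extChartAt I x).symm u) - i ((extChartAt I x).symm v)‖ ∧
        |f ((extChartAt I x).symm u) - f ((extChartAt I x).symm v)| ≤ G * ‖u - v‖) ∧
      ∀ u ∈ Metric.ball (extChartAt I x x) r,
        q₀ ≤ chartDensity I i p x u ∧ chartDensity I i p x u ≤ q₁ := by
  have hF := contDiffAt_comp_extChartAt_symm (n := ⊤) hi.contMDiff hx
  obtain ⟨L, hL, a, ha, r₁, hr₁, h₁⟩ :=
    (hF.hasStrictFDerivAt (by simp)).exists_bilipschitz (hi.injective_fderiv hx)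
  have hf' := contDiffAt_comp_extChartAt_symm (n := 3) hf hx
  obtain ⟨G, t, ht, hG⟩ := (hf'.of_le (m := 1) (by norm_num)).exists_lipschitzOnWith
  obtain ⟨r₂, hr₂, h₂⟩ := Metric.mem_nhds_iff.1 ht
  obtain ⟨r₃, hr₃, h₃⟩ := Metric.mem_nhds_iff.1 (extChartAt_target_mem_nhds_of_mem_interior hx)
  set q := chartDensity I i p x (extChartAt I x x) with hq
  have hq0 : 0 < q := hi.chartDensity_pos hx hpx
  have hcont := hi.continuousAt_chartDensity hp hx
  have hev : ∀ᶠ u in 𝓝 (extChartAt I x x),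
      q / 2 ≤ chartDensity I i p x u ∧ chartDensity I i p x u ≤ 2 * q :=
    (hcont.eventually (le_mem_nhds (by linarith))).and
      (hcont.eventually (ge_mem_nhds (by linarith)))
  obtain ⟨r₄, hr₄, h₄⟩ := Metric.mem_nhds_iff.1 hev
  set r := min (min r₁ r₂) (min r₃ r₄) with hr
  have e1 : Metric.ball (extChartAt I x x) r ⊆ Metric.ball (extChartAt I x x) r₁ :=
    Metric.ball_subset_ball ((min_le_left _ _).trans (min_le_left _ _))
  have e2 : Metric.ball (extChartAt I x x) r ⊆ Metric.ball (extChartAt I x x) r₂ :=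
    Metric.ball_subset_ball ((min_le_left _ _).trans (min_le_right _ _))
  have e3 : Metric.ball (extChartAt I x x) r ⊆ Metric.ball (extChartAt I x x) r₃ :=
    Metric.ball_subset_ball ((min_le_right _ _).trans (min_le_left _ _))
  have e4 : Metric.ball (extChartAt I x x) r ⊆ Metric.ball (extChartAt I x x) r₄ :=
    Metric.ball_subset_ball ((min_le_right _ _).trans (min_le_right _ _))
  refine ⟨L, hL, a, ha, q / 2, by linarith, 2 * q, by linarith, G + 1, by positivity, r,
    lt_min (lt_min hr₁ hr₂) (lt_min hr₃ hr₄), e3.trans h₃, fun u hu v hv => ?_,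
    fun u hu => h₄ (e4 hu)⟩
  refine ⟨(h₁ u (e1 hu) v (e1 hv)).1, (h₁ u (e1 hu) v (e1 hv)).2, ?_⟩
  have := hG.dist_le_mul u (h₂ (e2 hu)) v (h₂ (e2 hv))
  rw [Real.dist_eq, dist_eq_norm] at this
  refine this.trans ?_
  gcongr
  linarith

end LocalChart

/-! ### Measure of small extrinsic balls. -/

section VolumeOfBalls

variable {m d : ℕ}
  {H : Type*} [TopologicalSpace H]
  {I : ModelWithCorners ℝ (EuclideanSpace ℝ (Fin m)) H}
  {M : Type*} [EMetricSpace M] [ChartedSpace H M] [IsManifold I ∞ M]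
  [RiemannianBundle (fun x : M => TangentSpace I x)]
  {i : M → EuclideanSpace ℝ (Fin d)}

theorem Topology.IsEmbedding.exists_norm_sub_lt (hi : Topology.IsEmbedding i) {x : M} {U : Set M}
    (hU : U ∈ 𝓝 x) : ∃ δ > 0, ∀ z, ‖i x - i z‖ < δ → z ∈ U := by
  rw [hi.isInducing.nhds_eq_comap] at hU
  obtain ⟨V, hV, hVU⟩ := hU
  obtain ⟨δ, hδ, hδV⟩ := Metric.mem_nhds_iff.1 hV
  refine ⟨δ, hδ, fun z hz => hVU (hδV ?_)⟩
  rwa [Metric.mem_ball, dist_comm, dist_eq_norm]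

/-- Around an interior point, the measure `p dV` of an extrinsic ball of radius `r` is comparable
to `r ^ m`, and a `C^3` function is Lipschitz for the extrinsic distance. -/
theorem IsIsometricEmbedding.exists_measure_ball_bounds [MeasurableSpace M] [BorelSpace M]
    (hi : IsIsometricEmbedding I i) {P : Measure M}
    {p : M → ℝ} (hp : ContMDiff I 𝓘(ℝ, ℝ) 3 p) (hP : HasVolumeDensity I i P p)
    {f : M → ℝ} (hf : ContMDiff I 𝓘(ℝ, ℝ) 3 f)
    {x : M} (hx : x ∈ I.interior M) (hpx : 0 < p x) :
    ∃ r₀ > 0, ∃ c > 0, ∃ D > 0, ∃ G > 0, ∀ y, ‖i x - i y‖ < r₀ →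
      |f x - f y| ≤ G * ‖i x - i y‖ ∧ ∀ r, 0 < r → r < r₀ →
        ENNReal.ofReal (c * r ^ m) ≤ P {z | ‖i y - i z‖ < r} ∧
        P {z | ‖i y - i z‖ ≤ r} ≤ ENNReal.ofReal (D * r ^ m) := by
  obtain ⟨L, hL, a, ha, q₀, hq₀, q₁, hq₁, G, hG, ρ, hρ, htar, hlip, hq⟩ :=
    hi.exists_chart_ball hp hf hx hpx
  have hic : Continuous i := hi.contMDiff.continuous
  set φ := extChartAt I x with hφ
  set b := (volume (Metric.ball (0 : EuclideanSpace ℝ (Fin m)) 1)).toReal with hb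
  have hbfin : volume (Metric.ball (0 : EuclideanSpace ℝ (Fin m)) 1) ≠ ⊤ :=
    measure_ball_lt_top.ne
  have hbpos : 0 < b := ENNReal.toReal_pos (Metric.measure_ball_pos _ _ one_pos).ne' hbfin
  have hvol : ∀ (u : EuclideanSpace ℝ (Fin m)) (r : ℝ), 0 ≤ r →
      volume (Metric.closedBall u r) = ENNReal.ofReal (r ^ m * b) := by
    intro u r hr
    rw [Measure.addHaar_closedBall _ _ hr, finrank_euclideanSpace_fin,
      ← ENNReal.ofReal_toReal hbfin, ← ENNReal.ofReal_mul (by positivity)]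
  have hvol' : ∀ (u : EuclideanSpace ℝ (Fin m)) (r : ℝ), 0 < r →
      volume (Metric.ball u r) = ENNReal.ofReal (r ^ m * b) := by
    intro u r hr
    rw [Measure.addHaar_ball_of_pos _ _ hr, finrank_euclideanSpace_fin,
      ← ENNReal.ofReal_toReal hbfin, ← ENNReal.ofReal_mul (by positivity)]
  obtain ⟨δ, hδ, hδU⟩ := hi.isEmbedding.exists_norm_sub_lt (x := x)
    (Filter.inter_mem (extChartAt_source_mem_nhds (I := I) x)
      ((continuousAt_extChartAt (I := I) x).preimage_mem_nhds
        (Metric.ball_mem_nhds _ (half_pos hρ))))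
  have hsub : Metric.ball (φ x) (ρ / 2) ⊆ Metric.ball (φ x) ρ :=
    Metric.ball_subset_ball (by linarith)
  -- `δ / 2` keeps the whole extrinsic ball about `y` in the chart neighbourhood; `L * ρ / 2` keeps
  -- the chart ball of radius `r / L` inside the one of radius `ρ`. The two constants come from the
  -- inscribed chart ball of radius `r / L` and the circumscribed one of radius `a * r`.
  refine ⟨min (δ / 2) (L * ρ / 2), lt_min (by positivity) (by positivity),
    q₀ * ((1 / L) ^ m * b), by positivity, q₁ * (a ^ m * b), by positivity, G * a, by positivity,
    fun y hy => ?_⟩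
  have hyδ : ‖i x - i y‖ < δ / 2 := hy.trans_le (min_le_left _ _)
  obtain ⟨hys, hyb⟩ := hδU y (by linarith)
  have hyb : φ y ∈ Metric.ball (φ x) (ρ / 2) := hyb
  have hinv : ∀ z ∈ φ.source, i (φ.symm (φ z)) = i z := fun z hz => by rw [φ.left_inv hz]
  refine ⟨?_, fun r hr hr₀ => ⟨?_, ?_⟩⟩
  · obtain ⟨-, h2, h3⟩ := hlip (φ x) (Metric.mem_ball_self hρ) (φ y) (hsub hyb)
    rw [φ.left_inv hys, φ.left_inv (mem_extChartAt_source x)] at h2 h3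
    calc |f x - f y| ≤ G * ‖φ x - φ y‖ := h3
      _ ≤ G * (a * ‖i x - i y‖) := by gcongr
      _ = G * a * ‖i x - i y‖ := by ring
  · have hrL : r / L < ρ / 2 := by
      rw [div_lt_iff₀ hL]
      have := hr₀.trans_le (min_le_right _ _)
      linarith
    have hrL0 : 0 < r / L := by positivity
    have hball : Metric.ball (φ y) (r / L) ⊆ Metric.ball (φ x) ρ :=
      Metric.ball_subset_ball' (by rw [Metric.mem_ball] at hyb; linarith)
    set A := φ.source ∩ φ ⁻¹' Metric.ball (φ y) (r / L) with hA
    have hAo : IsOpen A := isOpen_extChartAt_preimage' x Metric.isOpen_ball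
    have himg : φ '' A = Metric.ball (φ y) (r / L) := by
      rw [hA, φ.image_source_inter_eq', inter_comm]
      ext u
      constructor
      · rintro ⟨hu, hut⟩
        have := hu
        simpa [φ.right_inv hut] using this
      · intro hu
        have hut := htar (hball hu)
        exact ⟨by simpa [φ.right_inv hut] using hu, hut⟩
    have hAsub : A ⊆ {z | ‖i y - i z‖ < r} := by
      rintro z ⟨hzs, hz⟩
      have hz' : φ z ∈ Metric.ball (φ y) (r / L) := hz
      obtain ⟨h1, -, -⟩ := hlip (φ y) (hsub hyb) (φ z) (hball hz')
      rw [hinv y hys, hinv z hzs] at h1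
      refine lt_of_le_of_lt h1 ?_
      rw [Metric.mem_ball, dist_comm, dist_eq_norm, lt_div_iff₀ hL] at hz'
      rw [mul_comm]; exact hz'
    refine le_trans ?_ (measure_mono hAsub)
    rw [hP x A hAo.measurableSet (by rw [← extChartAt_source I]; exact inter_subset_left)]
    change _ ≤ ∫⁻ u in φ '' A, ENNReal.ofReal (chartDensity I i p x u)
    rw [himg]
    calc ENNReal.ofReal (q₀ * ((1 / L) ^ m * b) * r ^ m)
        = ENNReal.ofReal q₀ * volume (Metric.ball (φ y) (r / L)) := by
          rw [hvol' _ _ hrL0, ← ENNReal.ofReal_mul hq₀.le]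
          congr 1; rw [div_pow, div_pow, one_pow]; ring
      _ = ∫⁻ u in Metric.ball (φ y) (r / L), ENNReal.ofReal q₀ := by
          rw [setLIntegral_const]
      _ ≤ _ := setLIntegral_mono' Metric.isOpen_ball.measurableSet
          fun u hu => ENNReal.ofReal_le_ofReal (hq u (hball hu)).1
  · set A := {z | ‖i y - i z‖ ≤ r} with hA
    have hAc : IsClosed A := isClosed_le (by fun_prop) continuous_const
    have hAU : ∀ z ∈ A, z ∈ φ.source ∧ φ z ∈ Metric.ball (φ x) (ρ / 2) := by
      intro z hz
      refine hδU z ?_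
      have h1 : r < δ / 2 := hr₀.trans_le (min_le_left _ _)
      have h2 : ‖i y - i z‖ ≤ r := hz
      calc ‖i x - i z‖ = ‖(i x - i y) + (i y - i z)‖ := by congr 1; abel
        _ ≤ ‖i x - i y‖ + ‖i y - i z‖ := norm_add_le _ _
        _ < δ := by linarith
    rw [hP x A hAc.measurableSet (by
      rw [← extChartAt_source I]; exact fun z hz => (hAU z hz).1)]
    change ∫⁻ u in φ '' A, ENNReal.ofReal (chartDensity I i p x u) ≤ _
    have himg : φ '' A ⊆ Metric.closedBall (φ y) (a * r) ∩ Metric.ball (φ x) ρ := by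
      rintro _ ⟨z, hz, rfl⟩
      obtain ⟨hzs, hzb⟩ := hAU z hz
      refine ⟨?_, hsub hzb⟩
      obtain ⟨-, h2, -⟩ := hlip (φ y) (hsub hyb) (φ z) (hsub hzb)
      rw [hinv y hys, hinv z hzs] at h2
      rw [Metric.mem_closedBall, dist_comm, dist_eq_norm]
      exact h2.trans (mul_le_mul_of_nonneg_left hz ha.le)
    calc ∫⁻ u in φ '' A, ENNReal.ofReal (chartDensity I i p x u)
        ≤ ∫⁻ u in Metric.closedBall (φ y) (a * r) ∩ Metric.ball (φ x) ρ,
            ENNReal.ofReal (chartDensity I i p x u) := lintegral_mono_set himg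
      _ ≤ ∫⁻ u in Metric.closedBall (φ y) (a * r) ∩ Metric.ball (φ x) ρ, ENNReal.ofReal q₁ :=
          setLIntegral_mono' (Metric.isClosed_closedBall.measurableSet.inter
            Metric.isOpen_ball.measurableSet)
            fun u hu => ENNReal.ofReal_le_ofReal (hq u hu.2).2
      _ ≤ ENNReal.ofReal q₁ * volume (Metric.closedBall (φ y) (a * r)) := by
          rw [setLIntegral_const]
          gcongr
          exact inter_subset_left
      _ = ENNReal.ofReal (q₁ * (a ^ m * b) * r ^ m) := by
          rw [hvol _ _ (by positivity), ← ENNReal.ofReal_mul hq₁.le]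
          congr 1; rw [mul_pow]; ring

/-- Near an interior point, the Riemannian distance is bounded by a multiple of the extrinsic
one. -/
theorem IsIsometricEmbedding.eventually_edist_le [IsRiemannianManifold I M]
    [IsContMDiffRiemannianBundle I ∞ (EuclideanSpace ℝ (Fin m))
      (fun x : M => TangentSpace I x)]
    (hi : IsIsometricEmbedding I i) {x : M} (hx : x ∈ I.interior M) :
    ∃ C : ℝ≥0, ∀ᶠ z in 𝓝 x, edist x z ≤ C * edist (i x) (i z) := by
  obtain ⟨L, hL, a, ha, q₀, hq₀, q₁, hq₁, G, hG, ρ, hρ, htar, hlip, hq⟩ :=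
    hi.exists_chart_ball (p := fun _ => 1) contMDiff_const (f := fun _ => 1) contMDiff_const hx
      one_pos
  have : IsManifold I 1 M := IsManifold.of_le (n := ∞) (by exact_mod_cast le_top)
  have : IsContinuousRiemannianBundle (EuclideanSpace ℝ (Fin m))
      (fun x : M => TangentSpace I x) := by
    obtain ⟨g, hg, heq⟩ := IsContMDiffRiemannianBundle.exists_contMDiff (IB := I) (n := ∞)
      (F := EuclideanSpace ℝ (Fin m)) (E := fun x : M => TangentSpace I x)
    exact ⟨g, hg.continuous, heq⟩
  obtain ⟨C, hC, hev⟩ := eventually_riemannianEDist_le_edist_extChartAt I x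
  refine ⟨C * a.toNNReal, ?_⟩
  filter_upwards [hev, extChartAt_source_mem_nhds (I := I) x,
    (continuousAt_extChartAt (I := I) x).preimage_mem_nhds (Metric.ball_mem_nhds _ hρ)]
    with z hz hzs hzb
  obtain ⟨-, h2, -⟩ := hlip _ (Metric.mem_ball_self hρ) _ hzb
  rw [(extChartAt I x).left_inv hzs, (extChartAt I x).left_inv (mem_extChartAt_source x)] at h2
  rw [IsRiemannianManifold.out (I := I)]
  refine hz.trans ?_
  rw [ENNReal.coe_mul, mul_assoc]
  gcongr
  rw [edist_dist, edist_dist, dist_eq_norm, dist_eq_norm, ← ENNReal.ofReal,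
    ← ENNReal.ofReal_mul ha.le]
  exact ENNReal.ofReal_le_ofReal h2

end VolumeOfBalls

/-! ### Balls have positive measure, up to the boundary. -/

section PositiveOnOpens

variable {m d : ℕ}
  {H : Type*} [TopologicalSpace H]
  {I : ModelWithCorners ℝ (EuclideanSpace ℝ (Fin m)) H}
  {M : Type*} [EMetricSpace M] [ChartedSpace H M] [IsManifold I ∞ M]

/-- The range of the model lies in the closure of its interior, and a point whose coordinates in
some chart of the atlas are interior is an interior point. -/
theorem dense_interior_manifold : Dense (I.interior M) := by
  have : IsManifold I 1 M := IsManifold.of_le (n := ∞) (by exact_mod_cast le_top)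
  intro x
  rw [mem_closure_iff_nhds]
  intro U hU
  set φ := extChartAt I x with hφ
  have h1 : φ.symm ⁻¹' U ∩ φ.target ∈ 𝓝[range I] (φ x) := by
    refine Filter.inter_mem ?_ (extChartAt_target_mem_nhdsWithin x)
    have h2 : Filter.Tendsto φ.symm (𝓝[range I] (φ x)) (𝓝 x) := by
      have := (continuousAt_extChartAt_symm (I := I) x).continuousWithinAt (s := range I)
      rwa [ContinuousWithinAt, extChartAt_to_inv] at this
    exact h2 hU
  obtain ⟨V, hVo, hxV, hV⟩ := mem_nhdsWithin.1 h1
  have h3 : φ x ∈ closure (interior (range I)) :=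
    I.range_subset_closure_interior (extChartAt_target_subset_range x (mem_extChartAt_target x))
  obtain ⟨w, hwV, hw⟩ := mem_closure_iff.1 h3 V hVo hxV
  obtain ⟨hwU, hwt⟩ := hV ⟨hwV, interior_subset hw⟩
  refine ⟨φ.symm w, hwU, ?_⟩
  have hs : φ.symm w ∈ (chartAt H x).source := by
    rw [← extChartAt_source I]; exact φ.map_target hwt
  have h4 := (ModelWithCorners.isInteriorPoint_iff_of_mem_atlas (I := I) (n := 1) (by simp)
    (chart_mem_atlas H x) hs).2
  refine h4 ((chartAt H x).mem_interior_extend_target ((chartAt H x).map_source hs) ?_)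
  have h5 : I (chartAt H x (φ.symm w)) = w := φ.right_inv hwt
  have h6 : I (chartAt H x (φ.symm w)) ∈ interior (range I) := by rwa [h5]
  exact h6

variable [RiemannianBundle (fun x : M => TangentSpace I x)]
  {i : M → EuclideanSpace ℝ (Fin d)} [MeasurableSpace M] [BorelSpace M]
  {P : Measure M} {p : M → ℝ}

-- Needed because `k 0 = 0` punctures the kernel at its centre.
omit [IsManifold I ∞ M] [RiemannianBundle (fun x : M => TangentSpace I x)] in
theorem HasVolumeDensity.measure_singleton_eq_zero (hm : 0 < m) (hP : HasVolumeDensity I i P p) (y : M) :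
    P {y} = 0 := by
  have : Nonempty (Fin m) := ⟨⟨0, hm⟩⟩
  rw [hP y {y} (measurableSet_singleton y) (by simp [mem_chart_source]), image_singleton]
  exact setLIntegral_measure_zero _ _ (measure_singleton _)

/-- Positivity of `p` is available only at interior points, but these are dense: a small ball about
one of them fits into the given ball. -/
theorem IsIsometricEmbedding.measure_ball_pos (hi : IsIsometricEmbedding I i)
    (hp : ContMDiff I 𝓘(ℝ, ℝ) 3 p) (hp_pos : ∀ y ∈ I.interior M, 0 < p y)
    (hP : HasVolumeDensity I i P p) (y : M) {r : ℝ} (hr : 0 < r) :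
    0 < P {z | ‖i y - i z‖ < r} := by
  have hic : Continuous i := hi.contMDiff.continuous
  have hopen : IsOpen {z | ‖i y - i z‖ < r} := isOpen_lt (by fun_prop) continuous_const
  obtain ⟨w, hwr, hw⟩ :=
    (dense_interior_manifold (I := I) (M := M)).exists_mem_open hopen ⟨y, by simpa using hr⟩
  obtain ⟨δ, hδ, hδU⟩ := hi.isEmbedding.exists_norm_sub_lt (hopen.mem_nhds hw)
  obtain ⟨r₀, hr₀, c, hc, _, _, _, _, hball⟩ := hi.exists_measure_ball_bounds hp hP
    (f := fun _ => 0) contMDiff_const hwr (hp_pos w hwr)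
  set s := min (δ / 2) (r₀ / 2) with hs
  have hs0 : 0 < s := lt_min (by linarith) (by linarith)
  have hsδ : s < δ := (min_le_left _ _).trans_lt (by linarith)
  have hsr : s < r₀ := (min_le_right _ _).trans_lt (by linarith)
  have h1 := ((hball w (by simpa using hr₀)).2 s hs0 hsr).1
  calc (0 : ℝ≥0∞) < ENNReal.ofReal (c * s ^ m) := by simpa using by positivity
    _ ≤ P {z | ‖i w - i z‖ < s} := h1
    _ ≤ _ := measure_mono fun z hz => hδU z (lt_trans hz hsδ)

/-- The measure of extrinsic balls of a fixed radius is bounded below on extrinsically bounded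
sets. -/
theorem IsIsometricEmbedding.exists_le_measure_ball (hi : IsIsometricEmbedding I i)
    (hp : ContMDiff I 𝓘(ℝ, ℝ) 3 p) (hp_pos : ∀ y ∈ I.interior M, 0 < p y)
    (hP : HasVolumeDensity I i P p) (x : M) {r : ℝ} (hr : 0 < r) (R : ℝ) :
    ∃ c > 0, ∀ y, ‖i x - i y‖ ≤ R → ENNReal.ofReal c ≤ P {z | ‖i y - i z‖ < r} := by
  set S : Set (EuclideanSpace ℝ (Fin d)) := i '' {y | ‖i x - i y‖ ≤ R} with hS
  have hSb : TotallyBounded S := by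
    refine TotallyBounded.subset ?_ (isCompact_closedBall (i x) R).totallyBounded
    rintro _ ⟨y, hy, rfl⟩
    rwa [Metric.mem_closedBall, dist_comm, dist_eq_norm]
  -- The net lives in `ℝ^d`, where boundedness suffices; its points are taken in the image of `i` so
  -- that their half-radius balls have positive measure.
  obtain ⟨t, htS, htf, ht⟩ := EMetric.totallyBounded_iff'.1 hSb (ENNReal.ofReal (r / 2))
    (by simpa using hr)
  have hpos : ∀ w ∈ t, ∃ c > 0, ENNReal.ofReal c ≤ P {z | ‖w - i z‖ < r / 2} := by
    intro w hw
    obtain ⟨y, -, rfl⟩ := htS hw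
    obtain ⟨c, hc0, hc⟩ := ENNReal.lt_iff_exists_nnreal_btwn.1
      (hi.measure_ball_pos hp hp_pos hP y (half_pos hr))
    exact ⟨c, by exact_mod_cast hc0, by simpa using hc.le⟩
  choose! c hc0 hc using hpos
  obtain ⟨c', hc', hle⟩ : ∃ c' > 0, ∀ w ∈ t, c' ≤ c w := by
    rcases t.eq_empty_or_nonempty with rfl | hne
    · exact ⟨1, one_pos, by simp⟩
    · obtain ⟨w₀, hw₀, hmin⟩ := htf.exists_minimalFor c t hne
      exact ⟨c w₀, hc0 w₀ hw₀, fun w hw => (le_total (c w₀) (c w)).elim id (hmin hw)⟩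
  refine ⟨c', hc', fun y hy => ?_⟩
  have hy' := ht ⟨y, hy, rfl⟩
  simp only [mem_iUnion, exists_prop] at hy'
  obtain ⟨w, hw, hyw⟩ := hy'
  refine (ENNReal.ofReal_le_ofReal (hle w hw)).trans ((hc w hw).trans (measure_mono ?_))
  intro z hz
  have hz' : ‖w - i z‖ < r / 2 := hz
  rw [Metric.mem_eball, edist_lt_ofReal, dist_eq_norm] at hyw
  calc ‖i y - i z‖ = ‖(i y - w) + (w - i z)‖ := by congr 1; abel
    _ ≤ ‖i y - w‖ + ‖w - i z‖ := norm_add_le _ _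
    _ < r := by linarith

end PositiveOnOpens

/-! ### Bernstein inequalities for product measures. -/

section Bernstein

variable {M : Type*} [MeasurableSpace M] {P : Measure M} [IsProbabilityMeasure P]

theorem integrable_of_measurable_of_abs_le {φ : M → ℝ} (hφ : Measurable φ) {b : ℝ}
    (hb : ∀ z, |φ z| ≤ b) : Integrable φ P :=
  Integrable.of_bound hφ.aestronglyMeasurable b (Filter.Eventually.of_forall hb)

/-- Integrate `e^u ≤ 1 + u + u²` for `|u| ≤ 1`: the linear term is centred and the quadratic one is
at most `t ^ 2 * v`. -/
theorem integral_exp_mul_sub_le {φ : M → ℝ} (hφ : Measurable φ) {b v t : ℝ}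
    (hb : ∀ z, |φ z| ≤ b) (hv : ∫ z, φ z ^ 2 ∂P ≤ v) (ht : |t| * (2 * b) ≤ 1) :
    ∫ z, Real.exp (t * (φ z - ∫ z, φ z ∂P)) ∂P ≤ Real.exp (t ^ 2 * v) := by
  set μ := ∫ z, φ z ∂P with hμ
  have hint : Integrable φ P := integrable_of_measurable_of_abs_le hφ hb
  have hint2 : Integrable (fun z => φ z ^ 2) P :=
    integrable_of_measurable_of_abs_le (hφ.pow_const 2) (b := b ^ 2) fun z => by
      rw [abs_pow]; exact pow_le_pow_left₀ (abs_nonneg _) (hb z) 2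
  have hμb : |μ| ≤ b := by
    have := norm_integral_le_of_norm_le_const (μ := P) (f := φ) (C := b)
      (Filter.Eventually.of_forall hb)
    simpa using this
  have hu : ∀ z, |t * (φ z - μ)| ≤ 1 := fun z => by
    rw [abs_mul]
    refine le_trans (mul_le_mul_of_nonneg_left ?_ (abs_nonneg t)) ht
    calc |φ z - μ| ≤ |φ z| + |μ| := abs_sub _ _
      _ ≤ 2 * b := by linarith [hb z]
  have hle : ∀ z, Real.exp (t * (φ z - μ)) ≤
      (1 - t * μ + t ^ 2 * μ ^ 2) + ((t - 2 * t ^ 2 * μ) * φ z + t ^ 2 * φ z ^ 2) := fun z => by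
    have := (abs_le.1 (Real.abs_exp_sub_one_sub_id_le (hu z))).2
    nlinarith
  have hexp : Integrable (fun z => Real.exp (t * (φ z - μ))) P :=
    integrable_of_measurable_of_abs_le (by fun_prop) (b := Real.exp 1) fun z => by
      rw [abs_of_pos (Real.exp_pos _)]
      exact Real.exp_le_exp.2 ((le_abs_self _).trans (hu z))
  have hi1 : Integrable (fun z => (t - 2 * t ^ 2 * μ) * φ z) P := hint.const_mul _
  have hi2 : Integrable (fun z => t ^ 2 * φ z ^ 2) P := hint2.const_mul _
  have hi3 : Integrable (fun z => (t - 2 * t ^ 2 * μ) * φ z + t ^ 2 * φ z ^ 2) P := hi1.add hi2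
  have hi4 : Integrable (fun z => (1 - t * μ + t ^ 2 * μ ^ 2) +
      ((t - 2 * t ^ 2 * μ) * φ z + t ^ 2 * φ z ^ 2)) P := (integrable_const _).add hi3
  have hcomp : ∫ z, ((1 - t * μ + t ^ 2 * μ ^ 2) +
      ((t - 2 * t ^ 2 * μ) * φ z + t ^ 2 * φ z ^ 2)) ∂P =
      1 + t ^ 2 * (∫ z, φ z ^ 2 ∂P - μ ^ 2) := by
    rw [integral_add (integrable_const _) hi3, integral_add hi1 hi2, integral_const_mul,
      integral_const_mul, ← hμ]
    simp only [integral_const, probReal_univ, one_smul]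
    ring
  calc ∫ z, Real.exp (t * (φ z - μ)) ∂P ≤ _ := integral_mono hexp hi4 hle
    _ = 1 + t ^ 2 * (∫ z, φ z ^ 2 ∂P - μ ^ 2) := hcomp
    _ ≤ 1 + t ^ 2 * v := by gcongr; nlinarith [sq_nonneg μ]
    _ = t ^ 2 * v + 1 := add_comm _ _
    _ ≤ _ := Real.add_one_le_exp _

theorem measure_pi_le_sum_sub_integral {N : ℕ} {φ : M → ℝ} (hφ : Measurable φ) {b v V s : ℝ}
    (hb : ∀ z, |φ z| ≤ b) (hv : ∫ z, φ z ^ 2 ∂P ≤ v) (hs : 0 < s) (hV : 0 < V)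
    (hNV : N * v ≤ V) (hsV : s * b ≤ V) :
    (Measure.pi fun _ : Fin N => P) {X | s ≤ ∑ j, (φ (X j) - ∫ z, φ z ∂P)} ≤
      ENNReal.ofReal (Real.exp (-(s ^ 2 / (4 * V)))) := by
  have hmgf := fun t => integral_exp_mul_sub_le (P := P) (t := t) hφ hb hv
  generalize ∫ z, φ z ∂P = μ at hmgf ⊢
  -- Minimizer of the Chernoff exponent `-t * s + t ^ 2 * V`; the condition `s * b ≤ V` is what
  -- makes it admissible for the bound on the exponential moment.
  obtain ⟨t, ht⟩ : ∃ t, t = s / (2 * V) := ⟨_, rfl⟩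
  have ht0 : 0 < t := by rw [ht]; positivity
  have htb : |t| * (2 * b) ≤ 1 := by
    rw [abs_of_pos ht0, ht, div_mul_eq_mul_div, div_le_one (by positivity)]
    linarith
  have hprod : ∀ X : Fin N → M, Real.exp (t * ∑ j, (φ (X j) - μ)) =
      ∏ j, Real.exp (t * (φ (X j) - μ)) := fun X => by
    rw [Finset.mul_sum, Real.exp_sum]
  have hexp : Integrable (fun z => Real.exp (t * (φ z - μ))) P :=
    integrable_of_measurable_of_abs_le (by fun_prop) (b := Real.exp (t * (b - μ))) fun z => by
      rw [abs_of_pos (Real.exp_pos _)]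
      gcongr
      exact (le_abs_self _).trans (hb z)
  have hint : Integrable (fun X : Fin N → M => Real.exp (t * ∑ j, (φ (X j) - μ)))
      (Measure.pi fun _ : Fin N => P) := by
    simp_rw [hprod]
    exact Integrable.fintype_prod (f := fun _ z => Real.exp (t * (φ z - μ))) fun _ => hexp
  set S : (Fin N → M) → ℝ := fun X => ∑ j, (φ (X j) - μ) with hS
  have h1 : (Measure.pi fun _ : Fin N => P).real {X | s ≤ S X} ≤
      Real.exp (-t * s) * mgf S (Measure.pi fun _ : Fin N => P) t :=
    measure_ge_le_exp_mul_mgf s ht0.le hint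
  have h2 : mgf S (Measure.pi fun _ : Fin N => P) t ≤ Real.exp (t ^ 2 * V) := by
    simp only [mgf, hS, hprod]
    rw [integral_fintype_prod_eq_pow (fun z => Real.exp (t * (φ z - μ)))]
    calc _ ≤ Real.exp (t ^ 2 * v) ^ Fintype.card (Fin N) :=
          pow_le_pow_left₀ (integral_nonneg fun z => (Real.exp_pos _).le)
            (hmgf t htb) _
      _ = Real.exp (t ^ 2 * (N * v)) := by
          rw [Fintype.card_fin, ← Real.exp_nat_mul]; ring_nf
      _ ≤ _ := by gcongr
  have h3 : Real.exp (-t * s) * Real.exp (t ^ 2 * V) = Real.exp (-(s ^ 2 / (4 * V))) := by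
    rw [← Real.exp_add]
    congr 1
    rw [ht]; field_simp; ring
  have h4 := h1.trans ((mul_le_mul_of_nonneg_left h2 (Real.exp_pos _).le).trans_eq h3)
  rwa [← ENNReal.ofReal_le_ofReal_iff (Real.exp_pos _).le, ofReal_measureReal] at h4

/-- A Bernstein inequality. -/
theorem measure_pi_le_abs_sum_sub {N : ℕ} {φ : M → ℝ} (hφ : Measurable φ) {b v V s : ℝ}
    (hb : ∀ z, |φ z| ≤ b) (hv : ∫ z, φ z ^ 2 ∂P ≤ v) (hs : 0 < s) (hV : 0 < V)
    (hNV : N * v ≤ V) (hsV : s * b ≤ V) :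
    (Measure.pi fun _ : Fin N => P) {X | s ≤ |∑ j, φ (X j) - N * ∫ z, φ z ∂P|} ≤
      ENNReal.ofReal (2 * Real.exp (-(s ^ 2 / (4 * V)))) := by
  have h1 := measure_pi_le_sum_sub_integral (N := N) hφ hb hv hs hV hNV hsV
  have h2 := measure_pi_le_sum_sub_integral (N := N) (P := P) (φ := fun z => -φ z) hφ.neg
    (by simpa using hb) (by simpa using hv) hs hV hNV hsV
  have hsub : {X : Fin N → M | s ≤ |∑ j, φ (X j) - N * ∫ z, φ z ∂P|} ⊆
      {X | s ≤ ∑ j, (φ (X j) - ∫ z, φ z ∂P)} ∪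
        {X | s ≤ ∑ j, (-φ (X j) - ∫ z, -φ z ∂P)} := by
    intro X hX
    rcases le_abs.1 (show s ≤ |_| from hX) with h | h
    · left
      simpa [Finset.sum_sub_distrib] using h
    · right
      simp only [mem_ofPred_eq, integral_neg, Finset.sum_sub_distrib, Finset.sum_neg_distrib,
        Finset.sum_const, Finset.card_univ, Fintype.card_fin, nsmul_eq_mul]
      linarith
  refine (measure_mono hsub).trans ((measure_union_le _ _).trans ((add_le_add h1 h2).trans ?_))
  rw [← ENNReal.ofReal_add (Real.exp_pos _).le (Real.exp_pos _).le, two_mul]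

/-- Bernstein's inequality for functions dominated by a kernel `w`. -/
theorem measure_pi_le_abs_sum_sub_of_dominated {N n : ℕ} (hn : 0 < n) (hNn : N ≤ n)
    {w φ : M → ℝ} (hw : Measurable w) (hφ : Measurable φ) {β D T δ : ℝ} (hβ : 0 < β)
    (hT : 0 < T) (hδ : 0 < δ) (hδD : δ ≤ D) (hw0 : ∀ z, 0 ≤ w z) (hwβ : ∀ z, w z ≤ β)
    (hwD : ∫ z, w z ∂P ≤ D) (hφw : ∀ z, |φ z| ≤ T * w z) :
    (Measure.pi fun _ : Fin N => P) {X | n * T * δ ≤ |∑ j, φ (X j) - N * ∫ z, φ z ∂P|} ≤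
      ENNReal.ofReal (2 * Real.exp (-(n * δ ^ 2 / (4 * β * D)))) := by
  have hD : 0 < D := hδ.trans_le hδD
  have hn' : (0 : ℝ) < n := by exact_mod_cast hn
  have hNn' : (N : ℝ) ≤ n := by exact_mod_cast hNn
  have hwint : Integrable w P :=
    integrable_of_measurable_of_abs_le hw fun z => by rw [abs_of_nonneg (hw0 z)]; exact hwβ z
  have hb : ∀ z, |φ z| ≤ T * β := fun z =>
    (hφw z).trans (mul_le_mul_of_nonneg_left (hwβ z) hT.le)
  -- One factor `w` is bounded by `β`, the other is integrated: this yields `β * D` rather than `β ^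
  -- 2`, hence the power `h ^ m` in the final exponent.
  have hv : ∫ z, φ z ^ 2 ∂P ≤ T ^ 2 * β * D := by
    calc ∫ z, φ z ^ 2 ∂P ≤ ∫ z, T ^ 2 * β * w z ∂P := by
          refine integral_mono (integrable_of_measurable_of_abs_le (hφ.pow_const 2)
            (b := (T * β) ^ 2) fun z => ?_) (hwint.const_mul _) fun z => ?_
          · rw [abs_pow]; exact pow_le_pow_left₀ (abs_nonneg _) (hb z) 2
          · have h1 : φ z ^ 2 ≤ (T * w z) ^ 2 := by
              rw [← sq_abs]; exact pow_le_pow_left₀ (abs_nonneg _) (hφw z) 2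
            calc φ z ^ 2 ≤ T ^ 2 * (w z * w z) := by rw [mul_pow] at h1; linarith [sq (w z)]
              _ ≤ T ^ 2 * (β * w z) := by
                gcongr
                · exact hw0 z
                · exact hwβ z
              _ = T ^ 2 * β * w z := by ring
      _ = T ^ 2 * β * ∫ z, w z ∂P := integral_const_mul _ _
      _ ≤ _ := by gcongr
  have h := measure_pi_le_abs_sum_sub (N := N) hφ hb hv (s := n * T * δ)
    (V := n * (T ^ 2 * β * D)) (by positivity) (by positivity) (by gcongr) (by
      calc n * T * δ * (T * β) = n * T ^ 2 * β * δ := by ring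
        _ ≤ n * T ^ 2 * β * D := by gcongr
        _ = _ := by ring)
  refine h.trans (le_of_eq ?_)
  congr 4
  field_simp

/-- Bernstein's inequality for degrees at sample points. -/
theorem measure_pi_le_abs_degree_sub {N : ℕ} (j : Fin (N + 1)) {W : M → M → ℝ}
    (hW : Measurable (Function.uncurry W)) {β D δ : ℝ} (hβ : 0 < β) (hδ : 0 < δ) (hδD : δ ≤ D)
    (hW0 : ∀ y z, 0 ≤ W y z) (hWβ : ∀ y z, W y z ≤ β) (hWdiag : ∀ y, W y y = 0)
    {Y : Set M} (hY : MeasurableSet Y) (hWD : ∀ y ∈ Y, ∫ z, W y z ∂P ≤ D) :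
    (Measure.pi fun _ : Fin (N + 1) => P)
      {X | X j ∈ Y ∧ (N + 1 : ℕ) * δ ≤ |∑ l, W (X j) (X l) - N * ∫ z, W (X j) z ∂P|} ≤
      ENNReal.ofReal (2 * Real.exp (-((N + 1 : ℕ) * δ ^ 2 / (4 * β * D)))) := by
  set K := ENNReal.ofReal (2 * Real.exp (-((N + 1 : ℕ) * δ ^ 2 / (4 * β * D)))) with hK
  set B : Set (M × (Fin N → M)) := {q | q.1 ∈ Y ∧
    (N + 1 : ℕ) * δ ≤ |∑ l, W q.1 (q.2 l) - N * ∫ z, W q.1 z ∂P|} with hB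
  have hWint : Measurable fun y => ∫ z, W y z ∂P :=
    (hW.stronglyMeasurable.integral_prod_right (ν := P)).measurable
  have hWm : ∀ l : Fin N, Measurable fun q : M × (Fin N → M) => W q.1 (q.2 l) := fun l =>
    hW.comp (measurable_fst.prodMk ((measurable_pi_apply l).comp measurable_snd))
  have hBm : MeasurableSet B := by
    have hBeq : B = Prod.fst ⁻¹' Y ∩ {q : M × (Fin N → M) | (N + 1 : ℕ) * δ ≤
        |∑ l, W q.1 (q.2 l) - N * ∫ z, W q.1 z ∂P|} := rfl
    rw [hBeq]
    refine (measurable_fst hY).inter (measurableSet_le measurable_const ?_)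
    refine Measurable.abs (Measurable.sub (Finset.measurable_sum _ fun l _ => hWm l) ?_)
    exact (hWint.comp measurable_fst).const_mul _
  -- Split off the coordinate `j`. Its own term is zero by `hWdiag`, so for fixed `X j` there remain
  -- `N` independent terms.
  have hmp := measurePreserving_piFinSuccAbove (fun _ : Fin (N + 1) => P) j
  have hset : {X : Fin (N + 1) → M | X j ∈ Y ∧
      (N + 1 : ℕ) * δ ≤ |∑ l, W (X j) (X l) - N * ∫ z, W (X j) z ∂P|} =
      MeasurableEquiv.piFinSuccAbove (fun _ => M) j ⁻¹' B := by
    ext X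
    simp only [hB, mem_ofPred_eq, mem_preimage]
    rw [Fin.sum_univ_succAbove _ j, hWdiag, zero_add]
    rfl
  rw [hset, hmp.measure_preimage hBm.nullMeasurableSet, Measure.prod_apply hBm]
  calc ∫⁻ y, (Measure.pi fun _ : Fin N => P) (Prod.mk y ⁻¹' B) ∂P
      ≤ ∫⁻ _, K ∂P := by
        refine lintegral_mono fun y => ?_
        by_cases hy : y ∈ Y
        · have h := measure_pi_le_abs_sum_sub_of_dominated (P := P) (N := N) (n := N + 1)
            (Nat.succ_pos N) (Nat.le_succ N) (hW.of_uncurry_left (x := y))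
            (hW.of_uncurry_left (x := y)) hβ one_pos hδ hδD (hW0 y) (hWβ y) (hWD y hy)
            (fun z => by rw [abs_of_nonneg (hW0 y z), one_mul])
          rw [mul_one] at h
          exact (measure_mono fun Z hZ => hZ.2).trans h
        · have : Prod.mk y ⁻¹' B = ∅ := by
            ext Z; simp [hB, hy]
          rw [this]; simp
    _ = K := by simp

end Bernstein

/-! ### Replacing empirical degrees by their means. -/

section Reweighting

/-- Compactness away from `0` and the mean value inequality. The normalization `U ≥ 1` lets `δ / U`
be used as a smaller deviation later. -/
theorem exists_rpow_bounds (lam : ℝ) {a b : ℝ} (ha : 0 < a) :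
    ∃ U ≥ 1, ∃ Λ ≥ 0, ∀ s ∈ Icc a b, 1 / s ^ lam ≤ U ∧
      ∀ t ∈ Icc a b, |1 / s ^ lam - 1 / t ^ lam| ≤ Λ * |s - t| := by
  have hpos : ∀ s ∈ Icc a b, 0 < s := fun s hs => ha.trans_le hs.1
  have hcont : ∀ μ : ℝ, ContinuousOn (fun s : ℝ => s ^ μ) (Icc a b) := fun μ =>
    continuousOn_id.rpow_const fun s hs => Or.inl (hpos s hs).ne'
  obtain ⟨U, hU⟩ := isCompact_Icc.exists_bound_of_continuousOn (hcont (-lam))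
  obtain ⟨Λ, hΛ⟩ := isCompact_Icc.exists_bound_of_continuousOn
    (continuousOn_const (c := -lam) |>.mul (hcont (-lam - 1)))
  have heq : ∀ s ∈ Icc a b, 1 / s ^ lam = s ^ (-lam) := fun s hs => by
    rw [Real.rpow_neg (hpos s hs).le, one_div]
  refine ⟨max U 1, le_max_right _ _, max Λ 0, le_max_right _ _, fun s hs => ⟨?_, fun t ht => ?_⟩⟩
  · rw [heq s hs]
    exact ((le_abs_self _).trans (hU s hs)).trans (le_max_left _ _)
  · rw [heq s hs, heq t ht]
    refine (convex_Icc a b).norm_image_sub_le_of_norm_hasDerivWithin_le (f := fun s => s ^ (-lam))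
      (f' := fun s => -lam * s ^ (-lam - 1)) (fun u hu => ?_)
      (fun u hu => (hΛ u hu).trans (le_max_left _ _)) ht hs
    exact (Real.hasDerivAt_rpow_const (Or.inl (hpos u hu).ne')).hasDerivWithinAt

variable {M : Type*} [MeasurableSpace M]

/-- A kernel `W`, bounded by `β`, whose degree function lies in `[c, D]` on a set `Y` that carries
the weights at the point `x`. -/
structure IsLocalKernel (P : Measure M) (W : M → M → ℝ) (Y : Set M) (x : M) (β c D : ℝ) :
    Prop where
  measurable : Measurable (Function.uncurry W)
  nonneg : ∀ y z, 0 ≤ W y z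
  le : ∀ y z, W y z ≤ β
  diag : ∀ y, W y y = 0
  pos : 0 < β
  measurableSet : MeasurableSet Y
  mem : x ∈ Y
  eq_zero : ∀ z, z ∉ Y → W x z = 0
  c_pos : 0 < c
  le_integral : ∀ y ∈ Y, c ≤ ∫ z, W y z ∂P
  integral_le : ∀ y ∈ Y, ∫ z, W y z ∂P ≤ D

variable {P : Measure M} {W : M → M → ℝ} {Y : Set M} {x : M} {β c D : ℝ}

theorem IsLocalKernel.c_le (hW : IsLocalKernel P W Y x β c D) : c ≤ D :=
  (hW.le_integral x hW.mem).trans (hW.integral_le x hW.mem)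

/-- On the event that all degrees are close to their means, the reweighted empirical average is
close to its mean. -/
theorem IsLocalKernel.abs_reweighted_sub_le (hW : IsLocalKernel P W Y x β c D)
    {lam Λ δ τ : ℝ} (hΛ0 : 0 ≤ Λ)
    (hΛ : ∀ s ∈ Icc (c ^ 2 / 4) (4 * D ^ 2), ∀ t ∈ Icc (c ^ 2 / 4) (4 * D ^ 2),
      |1 / s ^ lam - 1 / t ^ lam| ≤ Λ * |s - t|)
    {N : ℕ} (hδ : 0 < δ) (hδc : 4 * δ ≤ c) (hDδ : D ≤ (N + 1 : ℕ) * δ) {g : M → ℝ}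
    (hg : ∀ y ∈ Y, |g y| ≤ τ) (X : Fin (N + 1) → M)
    (h₀ : |∑ j, W x (X j) - (N + 1 : ℕ) * ∫ z, W x z ∂P| ≤ (N + 1 : ℕ) * δ)
    (h₁ : ∀ j, X j ∈ Y → |∑ l, W (X j) (X l) - N * ∫ z, W (X j) z ∂P| ≤ (N + 1 : ℕ) * δ)
    (h₂ : |∑ j, W x (X j) / ((∫ z, W x z ∂P) * ∫ z, W (X j) z ∂P) ^ lam * g (X j) -
      (N + 1 : ℕ) * ∫ y, W x y / ((∫ z, W x z ∂P) * ∫ z, W y z ∂P) ^ lam * g y ∂P| ≤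
        (N + 1 : ℕ) * τ * δ) :
    |1 / ((N + 1 : ℕ) : ℝ) * ∑ j, W x (X j) /
        ((1 / ((N + 1 : ℕ) : ℝ) * ∑ l, W x (X l)) *
          (1 / ((N + 1 : ℕ) : ℝ) * ∑ l, W (X j) (X l))) ^ lam * g (X j) -
      ∫ y, W x y / ((∫ z, W x z ∂P) * ∫ z, W y z ∂P) ^ lam * g y ∂P| ≤
      τ * ((1 + 8 * D ^ 2 * Λ) * δ) := by
  set n : ℝ := ((N + 1 : ℕ) : ℝ) with hn
  have hNn : (N : ℝ) = n - 1 := by rw [hn]; push_cast; ring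
  have hn0 : 0 < n := by rw [hn]; positivity
  rw [hNn] at h₁
  set p : M → ℝ := fun y => ∫ z, W y z ∂P with hp
  set e : M → ℝ := fun y => 1 / n * ∑ l, W y (X l) with he
  have hc := hW.c_pos
  have hcD := hW.c_le
  have hD0 : 0 ≤ D := hc.le.trans hcD
  have hτ : 0 ≤ τ := (abs_nonneg _).trans (hg x hW.mem)
  have hsum : ∀ y, ∑ l, W y (X l) = n * e y := fun y => by
    simp only [he]; field_simp
  have hex : |e x - p x| ≤ δ := by
    have h3 : n * |e x - p x| ≤ n * δ := by
      rw [← abs_of_pos hn0, ← abs_mul, abs_of_pos hn0, mul_sub, ← hsum]; exact h₀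
    exact le_of_mul_le_mul_left h3 hn0
  -- At a sample point the sum has `n - 1` random terms but is divided by `n`; the missing mean `p
  -- (X j) ≤ D ≤ n * δ` accounts for the second `δ`.
  have hej : ∀ j, X j ∈ Y → |e (X j) - p (X j)| ≤ 2 * δ := by
    intro j hj
    have h3 : n * |e (X j) - p (X j)| ≤ n * (2 * δ) := by
      rw [← abs_of_pos hn0, ← abs_mul, abs_of_pos hn0, mul_sub, ← hsum]
      have h4 : ∑ l, W (X j) (X l) - n * p (X j) =
          (∑ l, W (X j) (X l) - (n - 1) * p (X j)) - p (X j) := by ring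
      have h5 : |p (X j)| ≤ D := by
        rw [abs_of_nonneg (hc.le.trans (hW.le_integral _ hj))]; exact hW.integral_le _ hj
      rw [h4]
      refine (abs_sub _ _).trans ?_
      linarith [h₁ j hj]
    exact le_of_mul_le_mul_left h3 hn0
  have hpx : c ≤ p x ∧ p x ≤ D := ⟨hW.le_integral x hW.mem, hW.integral_le x hW.mem⟩
  have hex' := abs_le.1 hex
  -- Errors of at most `2 * δ ≤ c / 2` keep the empirical degrees in `[c / 2, 2 * D]`.
  have hIcc : ∀ s t, c / 2 ≤ s → s ≤ 2 * D → c / 2 ≤ t → t ≤ 2 * D →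
      s * t ∈ Icc (c ^ 2 / 4) (4 * D ^ 2) := by
    intro s t h1 h2 h3 h4
    constructor <;> nlinarith
  have hterm : ∀ j, |W x (X j) / (e x * e (X j)) ^ lam * g (X j) -
      W x (X j) / (p x * p (X j)) ^ lam * g (X j)| ≤ W x (X j) * (4 * D * Λ * δ * τ) := by
    intro j
    by_cases hj : X j ∈ Y
    · have h3 := abs_le.1 (hej j hj)
      have h4 : c ≤ p (X j) ∧ p (X j) ≤ D := ⟨hW.le_integral _ hj, hW.integral_le _ hj⟩
      have h5 := hΛ (e x * e (X j))
        (hIcc _ _ (by linarith) (by linarith) (by linarith) (by linarith))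
        (p x * p (X j)) (hIcc _ _ (by linarith) (by linarith) (by linarith) (by linarith))
      have h6 : |e x * e (X j) - p x * p (X j)| ≤ 4 * D * δ := by
        have : e x * e (X j) - p x * p (X j) =
            (e x - p x) * e (X j) + p x * (e (X j) - p (X j)) := by ring
        rw [this]
        refine (abs_add_le _ _).trans ?_
        rw [abs_mul (e x - p x), abs_mul (p x), abs_of_nonneg (show 0 ≤ e (X j) by linarith),
          abs_of_nonneg (show 0 ≤ p x by linarith)]
        have h7 : |e x - p x| * e (X j) ≤ δ * (2 * D) :=
          mul_le_mul hex (by linarith) (by linarith) hδ.le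
        have h8 : p x * |e (X j) - p (X j)| ≤ D * (2 * δ) :=
          mul_le_mul hpx.2 (hej j hj) (abs_nonneg _) hD0
        linarith
      have h7 : W x (X j) / (e x * e (X j)) ^ lam * g (X j) -
          W x (X j) / (p x * p (X j)) ^ lam * g (X j) =
          W x (X j) * ((1 / (e x * e (X j)) ^ lam - 1 / (p x * p (X j)) ^ lam) * g (X j)) := by
        ring
      rw [h7, abs_mul, abs_of_nonneg (hW.nonneg _ _), abs_mul]
      refine mul_le_mul_of_nonneg_left ?_ (hW.nonneg _ _)
      calc _ ≤ (Λ * (4 * D * δ)) * τ :=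
            mul_le_mul (h5.trans (by gcongr)) (hg _ hj) (abs_nonneg _) (by positivity)
        _ = _ := by ring
    · simp [hW.eq_zero _ hj]
  set A := ∫ y, W x y / (p x * p y) ^ lam * g y ∂P with hA
  have h3 : |∑ j, W x (X j) / (e x * e (X j)) ^ lam * g (X j) - n * A| ≤
      n * (τ * ((1 + 8 * D ^ 2 * Λ) * δ)) := by
    -- The weights `W x (X j)` sum to `n * e x ≤ 2 * D * n`, so the termwise errors do not
    -- accumulate by a factor `β`.
    have h4 : |∑ j, W x (X j) / (e x * e (X j)) ^ lam * g (X j) -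
        ∑ j, W x (X j) / (p x * p (X j)) ^ lam * g (X j)| ≤ n * (2 * D) * (4 * D * Λ * δ * τ) := by
      rw [← Finset.sum_sub_distrib]
      refine (Finset.abs_sum_le_sum_abs _ _).trans ((Finset.sum_le_sum fun j _ => hterm j).trans ?_)
      rw [← Finset.sum_mul, hsum]
      have : 0 ≤ 4 * D * Λ * δ * τ := by positivity
      gcongr
      linarith
    calc _ ≤ _ := abs_sub_le _ (∑ j, W x (X j) / (p x * p (X j)) ^ lam * g (X j)) _
      _ ≤ n * (2 * D) * (4 * D * Λ * δ * τ) + n * τ * δ := add_le_add h4 h₂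
      _ = _ := by ring
  have h5 : n * |1 / n * ∑ j, W x (X j) / (e x * e (X j)) ^ lam * g (X j) - A| ≤
      n * (τ * ((1 + 8 * D ^ 2 * Λ) * δ)) := by
    rw [← abs_of_pos hn0, ← abs_mul, abs_of_pos hn0, mul_sub, ← mul_assoc, mul_one_div_cancel hn0.ne',
      one_mul]
    exact h3
  exact le_of_mul_le_mul_left h5 hn0

/-- Concentration of the reweighted empirical average and degree. -/
theorem IsLocalKernel.measure_pi_not_le [IsProbabilityMeasure P]
    (hW : IsLocalKernel P W Y x β c D)
    {lam U Λ δ τ : ℝ} (hU1 : 1 ≤ U) (hΛ0 : 0 ≤ Λ)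
    (hUΛ : ∀ s ∈ Icc (c ^ 2 / 4) (4 * D ^ 2), 1 / s ^ lam ≤ U ∧
      ∀ t ∈ Icc (c ^ 2 / 4) (4 * D ^ 2), |1 / s ^ lam - 1 / t ^ lam| ≤ Λ * |s - t|)
    {N : ℕ} (hδ : 0 < δ) (hδc : 4 * δ ≤ c) (hDδ : D ≤ (N + 1 : ℕ) * δ) {g : M → ℝ}
    (hgm : Measurable g) (hτ : 0 < τ) (hg : ∀ y ∈ Y, |g y| ≤ τ) :
    (Measure.pi fun _ : Fin (N + 1) => P) {X | ¬
      (|1 / ((N + 1 : ℕ) : ℝ) * ∑ j, W x (X j) /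
          ((1 / ((N + 1 : ℕ) : ℝ) * ∑ l, W x (X l)) *
            (1 / ((N + 1 : ℕ) : ℝ) * ∑ l, W (X j) (X l))) ^ lam * g (X j) -
        ∫ y, W x y / ((∫ z, W x z ∂P) * ∫ z, W y z ∂P) ^ lam * g y ∂P| ≤
        τ * ((1 + 8 * D ^ 2 * Λ) * δ) ∧
      |1 / ((N + 1 : ℕ) : ℝ) * ∑ j, W x (X j) /
          ((1 / ((N + 1 : ℕ) : ℝ) * ∑ l, W x (X l)) *
            (1 / ((N + 1 : ℕ) : ℝ) * ∑ l, W (X j) (X l))) ^ lam -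
        ∫ y, W x y / ((∫ z, W x z ∂P) * ∫ z, W y z ∂P) ^ lam ∂P| ≤
        (1 + 8 * D ^ 2 * Λ) * δ)} ≤
      ENNReal.ofReal (8 * (N + 1 : ℕ) *
        Real.exp (-((N + 1 : ℕ) * (δ / U) ^ 2 / (4 * β * D)))) := by
  set n : ℕ := N + 1 with hn
  have hn1 : (1 : ℝ) ≤ n := by rw [hn]; push_cast; linarith [(Nat.cast_nonneg N : (0 : ℝ) ≤ N)]
  have hU0 : 0 < U := by linarith
  have hc := hW.c_pos
  have hcD := hW.c_le
  have hD : 0 < D := hc.trans_le hcD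
  have hβ := hW.pos
  set K := 2 * Real.exp (-(n * (δ / U) ^ 2 / (4 * β * D))) with hK
  have hK0 : 0 < K := by positivity
  set φ : (M → ℝ) → M → ℝ := fun g y =>
    W x y / ((∫ z, W x z ∂P) * ∫ z, W y z ∂P) ^ lam * g y with hφ
  have hWx : Measurable (W x) := hW.measurable.of_uncurry_left
  have hp : Measurable fun y => ∫ z, W y z ∂P :=
    (hW.measurable.stronglyMeasurable.integral_prod_right (ν := P)).measurable
  have hφm : ∀ g : M → ℝ, Measurable g → Measurable (φ g) := fun g hg =>
    (hWx.div ((hp.const_mul _).pow_const lam)).mul hg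
  have hφle : ∀ (g : M → ℝ) (σ : ℝ), (∀ y ∈ Y, |g y| ≤ σ) → ∀ y, |φ g y| ≤ U * σ * W x y := by
    intro g σ hg y
    by_cases hy : y ∈ Y
    · have h1 := hW.le_integral x hW.mem
      have h2 := hW.integral_le x hW.mem
      have h3 := hW.le_integral y hy
      have h4 := hW.integral_le y hy
      have h5 := (hUΛ ((∫ z, W x z ∂P) * ∫ z, W y z ∂P) ⟨by nlinarith, by nlinarith⟩).1
      have h6 : 0 ≤ 1 / ((∫ z, W x z ∂P) * ∫ z, W y z ∂P) ^ lam := by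
        have : 0 ≤ (∫ z, W x z ∂P) * ∫ z, W y z ∂P := mul_nonneg (by linarith) (by linarith)
        positivity
      simp only [hφ]
      rw [div_eq_mul_one_div, abs_mul, abs_mul, abs_of_nonneg (hW.nonneg x y), abs_of_nonneg h6]
      calc _ ≤ W x y * U * σ := by
            have := hW.nonneg x y
            exact mul_le_mul (mul_le_mul_of_nonneg_left h5 this) (hg y hy) (abs_nonneg _)
              (by positivity)
        _ = _ := by ring
    · simp [hφ, hW.eq_zero y hy]
  have hδU : δ / U ≤ δ := div_le_self hδ.le hU1
  -- Domination holds with constant `U * σ`, so the deviation `δ / U` is used to end with `n * σ *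
  -- δ`.
  have hB : ∀ (g : M → ℝ) (σ : ℝ), 0 < σ → Measurable g → (∀ y ∈ Y, |g y| ≤ σ) →
      (Measure.pi fun _ : Fin n => P) {X | n * σ * δ ≤ |∑ j, φ g (X j) - n * ∫ z, φ g z ∂P|} ≤
        ENNReal.ofReal K := by
    intro g σ hσ hgm hg
    have := measure_pi_le_abs_sum_sub_of_dominated (P := P) (N := n) (n := n) (Nat.succ_pos N) le_rfl
      hWx (hφm g hgm) hβ (mul_pos hU0 hσ) (div_pos hδ hU0) (by linarith) (hW.nonneg x) (hW.le x)
      (hW.integral_le x hW.mem) (hφle g σ hg)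
    have h2 : n * (U * σ) * (δ / U) = n * σ * δ := by field_simp
    rwa [h2] at this
  have hKle : ENNReal.ofReal (2 * Real.exp (-(n * δ ^ 2 / (4 * β * D)))) ≤ ENNReal.ofReal K := by
    rw [hK]
    gcongr
  have hB0 : (Measure.pi fun _ : Fin n => P)
      {X | n * δ ≤ |∑ j, W x (X j) - n * ∫ z, W x z ∂P|} ≤ ENNReal.ofReal K := by
    have := measure_pi_le_abs_sum_sub_of_dominated (P := P) (N := n) (n := n) (Nat.succ_pos N) le_rfl
      hWx hWx hβ one_pos hδ (by linarith) (hW.nonneg x) (hW.le x)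
      (hW.integral_le x hW.mem) (fun z => by rw [one_mul, abs_of_nonneg (hW.nonneg x z)])
    rw [mul_one] at this
    exact this.trans hKle
  have hBj : ∀ j : Fin n, (Measure.pi fun _ : Fin n => P)
      {X | X j ∈ Y ∧ n * δ ≤ |∑ l, W (X j) (X l) - N * ∫ z, W (X j) z ∂P|} ≤ ENNReal.ofReal K :=
    fun j => (measure_pi_le_abs_degree_sub j hW.measurable hβ hδ (by linarith) hW.nonneg hW.le
      hW.diag hW.measurableSet hW.integral_le).trans hKle
  set E₀ := {X : Fin n → M | n * δ ≤ |∑ j, W x (X j) - n * ∫ z, W x z ∂P|} with hE₀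
  set E₁ := {X : Fin n → M | n * τ * δ ≤ |∑ j, φ g (X j) - n * ∫ z, φ g z ∂P|} with hE₁
  set E₂ := {X : Fin n → M | n * 1 * δ ≤
    |∑ j, φ (fun _ => 1) (X j) - n * ∫ z, φ (fun _ => 1) z ∂P|} with hE₂
  set F : Fin n → Set (Fin n → M) := fun j =>
    {X | X j ∈ Y ∧ n * δ ≤ |∑ l, W (X j) (X l) - N * ∫ z, W (X j) z ∂P|} with hF
  have hsub : ∀ X, X ∉ (E₀ ∪ E₁) ∪ (E₂ ∪ ⋃ j, F j) →
      (|1 / (n : ℝ) * ∑ j, W x (X j) / ((1 / (n : ℝ) * ∑ l, W x (X l)) *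
            (1 / (n : ℝ) * ∑ l, W (X j) (X l))) ^ lam * g (X j) -
        ∫ y, W x y / ((∫ z, W x z ∂P) * ∫ z, W y z ∂P) ^ lam * g y ∂P| ≤
        τ * ((1 + 8 * D ^ 2 * Λ) * δ) ∧
      |1 / (n : ℝ) * ∑ j, W x (X j) / ((1 / (n : ℝ) * ∑ l, W x (X l)) *
            (1 / (n : ℝ) * ∑ l, W (X j) (X l))) ^ lam -
        ∫ y, W x y / ((∫ z, W x z ∂P) * ∫ z, W y z ∂P) ^ lam ∂P| ≤
        (1 + 8 * D ^ 2 * Λ) * δ) := by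
    intro X hX
    simp only [mem_union, mem_iUnion, not_or, not_exists] at hX
    obtain ⟨⟨h0, h1⟩, h2, h3⟩ := hX
    have h0' : |∑ j, W x (X j) - n * ∫ z, W x z ∂P| ≤ n * δ := le_of_not_ge h0
    have h1' : |∑ j, φ g (X j) - n * ∫ z, φ g z ∂P| ≤ n * τ * δ := le_of_not_ge h1
    have h2' : |∑ j, φ (fun _ => 1) (X j) - n * ∫ z, φ (fun _ => 1) z ∂P| ≤ n * 1 * δ :=
      le_of_not_ge h2
    have h3' : ∀ j, X j ∈ Y → |∑ l, W (X j) (X l) - N * ∫ z, W (X j) z ∂P| ≤ n * δ :=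
      fun j hj => by
        by_contra! h
        exact h3 j ⟨hj, h.le⟩
    have hΛ : ∀ s ∈ Icc (c ^ 2 / 4) (4 * D ^ 2), ∀ t ∈ Icc (c ^ 2 / 4) (4 * D ^ 2),
        |1 / s ^ lam - 1 / t ^ lam| ≤ Λ * |s - t| := fun s hs => (hUΛ s hs).2
    refine ⟨hW.abs_reweighted_sub_le hΛ0 hΛ hδ hδc hDδ hg X h0' h3' h1', ?_⟩
    have := hW.abs_reweighted_sub_le hΛ0 hΛ hδ hδc hDδ (g := fun _ => 1) (τ := 1)
      (by simp) X h0' h3' h2'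
    simpa only [mul_one, one_mul] using this
  refine (measure_mono (t := (E₀ ∪ E₁) ∪ (E₂ ∪ ⋃ j, F j))
    fun X hX => by
      by_contra h
      exact hX (hsub X h)).trans ?_
  have hsum : (Measure.pi fun _ : Fin n => P) (⋃ j, F j) ≤ n * ENNReal.ofReal K := by
    refine (measure_iUnion_fintype_le _ _).trans ((Finset.sum_le_sum fun j _ => hBj j).trans ?_)
    simp
  have hE₂le := hB (fun _ => 1) 1 one_pos measurable_const (by simp)
  calc (Measure.pi fun _ : Fin n => P) ((E₀ ∪ E₁) ∪ (E₂ ∪ ⋃ j, F j))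
      ≤ (ENNReal.ofReal K + ENNReal.ofReal K) + (ENNReal.ofReal K + n * ENNReal.ofReal K) :=
        (measure_union_le _ _).trans (add_le_add
          ((measure_union_le _ _).trans (add_le_add hB0 (hB g τ hτ hgm hg)))
          ((measure_union_le _ _).trans (add_le_add hE₂le hsum)))
    _ = ENNReal.ofReal ((3 + n) * K) := by
        rw [← ENNReal.ofReal_natCast, ← ENNReal.ofReal_mul (by positivity),
          ← ENNReal.ofReal_add hK0.le hK0.le, ← ENNReal.ofReal_add hK0.le (by positivity),
          ← ENNReal.ofReal_add (by positivity) (by positivity)]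
        congr 1; ring
    -- There are `n + 3` bad events, each of probability at most `2 * exp(…)`, and `2 * (n + 3) ≤ 8
    -- * n`.
    _ ≤ _ := by
        refine ENNReal.ofReal_le_ofReal ?_
        rw [hK]
        have := Real.exp_pos (-(n * (δ / U) ^ 2 / (4 * β * D)))
        nlinarith

end Reweighting

/-! ### Uniform bounds for the scaled kernel. -/

section ScaledKernel

variable {k : ℝ → ℝ}

theorem IsAdmissibleKernel.exists_le (hk : IsAdmissibleKernel k) :
    ∃ B > 0, ∀ t, 0 ≤ t → k t ≤ B := by
  obtain ⟨B, hB⟩ := hk.bounded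
  refine ⟨|B| + 1, by positivity, fun t ht => ?_⟩
  rcases ht.eq_or_lt with rfl | ht
  · rw [hk.zero]; positivity
  · exact (le_abs_self _).trans ((hB t ht).1.trans ((le_abs_self B).trans (by linarith)))

theorem scaledKernel_nonneg (hk : IsAdmissibleKernel k) (m : ℕ) {h t : ℝ} (hh : 0 < h)
    (ht : 0 ≤ t) : 0 ≤ scaledKernel k m h t :=
  mul_nonneg (by positivity) (hk.nonneg _ (by positivity))

theorem integral_le_of_le_indicator {M : Type*} [MeasurableSpace M] {P : Measure M} [IsProbabilityMeasure P] {w : M → ℝ}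
    {S : Set M} (hS : MeasurableSet S) {b : ℝ} (hw : ∀ z, w z ≤ S.indicator (fun _ => b) z)
    (hw0 : ∀ z, 0 ≤ w z) : ∫ z, w z ∂P ≤ b * P.real S := by
  calc ∫ z, w z ∂P ≤ ∫ z, S.indicator (fun _ => b) z ∂P :=
        integral_mono_of_nonneg (Filter.Eventually.of_forall hw0)
          ((integrable_const b).indicator hS) (Filter.Eventually.of_forall hw)
    _ = b * P.real S := by rw [integral_indicator_const _ hS, smul_eq_mul, mul_comm]

theorem le_integral_of_indicator_le {M : Type*} [MeasurableSpace M] {P : Measure M} [IsProbabilityMeasure P] {w : M → ℝ}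
    (hw : Integrable w P) {S : Set M} (hS : MeasurableSet S) {b : ℝ}
    (hle : ∀ z, S.indicator (fun _ => b) z ≤ w z) : b * P.real S ≤ ∫ z, w z ∂P := by
  calc b * P.real S = ∫ z, S.indicator (fun _ => b) z ∂P := by
        rw [integral_indicator_const _ hS, smul_eq_mul, mul_comm]
    _ ≤ _ := integral_mono ((integrable_const b).indicator hS) hw hle

variable {m d : ℕ}
  {H : Type*} [TopologicalSpace H]
  {I : ModelWithCorners ℝ (EuclideanSpace ℝ (Fin m)) H}
  {M : Type*} [EMetricSpace M] [ChartedSpace H M] [IsManifold I ∞ M]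
  [RiemannianBundle (fun x : M => TangentSpace I x)]
  {i : M → EuclideanSpace ℝ (Fin d)} [MeasurableSpace M] [BorelSpace M]

theorem measurable_scaledKernel (hk : IsAdmissibleKernel k) (hi : Continuous i) (m : ℕ) (h : ℝ) :
    Measurable (Function.uncurry fun y z : M => scaledKernel k m h (‖i y - i z‖ ^ 2)) := by
  have h1 : Measurable fun q : M × M => ‖i q.1 - i q.2‖ ^ 2 / h ^ 2 :=
    ((((hi.measurable.comp measurable_fst).sub (hi.measurable.comp measurable_snd)).norm).pow_const
      2).div_const _
  exact (hk.measurable.comp h1).const_mul _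

/-- Uniformly in the bandwidth, the kernel `k_h` is local around an interior point. -/
theorem IsIsometricEmbedding.exists_isLocalKernel (hm : 0 < m)
    [IsContMDiffRiemannianBundle I ∞ (EuclideanSpace ℝ (Fin m))
      (fun x : M => TangentSpace I x)]
    [IsRiemannianManifold I M] [CompleteSpace M]
    (hi : IsIsometricEmbedding I i) (hk : IsAdmissibleKernel k)
    {Rk : ℝ} (hRk : 0 < Rk) (hsupp : ∀ t, Rk ^ 2 < t → k t = 0)
    {P : Measure M} [IsProbabilityMeasure P]
    {p : M → ℝ} (hp : ContMDiff I 𝓘(ℝ, ℝ) 3 p) (hp_pos : ∀ y ∈ I.interior M, 0 < p y)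
    (hP : HasVolumeDensity I i P p) {x : M} (hx : x ∈ I.interior M)
    {f : M → ℝ} (hf : ContMDiff I 𝓘(ℝ, ℝ) 3 f)
    {hmax : ℝ} (hmax0 : 0 < hmax) (hmax_le : ENNReal.ofReal (2 * Rk * hmax) ≤ kappa i)
    {t₀ : ℝ} (ht₀ : 0 < t₀) (hkt₀ : 0 < k t₀) :
    ∃ B > 0, ∃ c, ∃ D, ∃ G > 0, ∀ h, 0 < h → h < hmax →
      IsLocalKernel P (fun y z => scaledKernel k m h (‖i y - i z‖ ^ 2))
        {y | ‖i x - i y‖ ≤ Rk * h} x (B / h ^ m) c D ∧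
      ∀ y, ‖i x - i y‖ ≤ Rk * h → |f x - f y| ≤ G * h := by
  have hic : Continuous i := hi.contMDiff.continuous
  have hfc : Continuous f := hf.continuous
  obtain ⟨B, hB, hkB⟩ := hk.exists_le
  obtain ⟨r₀, hr₀, c₀, hc₀, D₀, hD₀, G₀, hG₀, hloc⟩ :=
    hi.exists_measure_ball_bounds hp hP hf hx (hp_pos x hx)
  set u := √t₀ with hu
  have hu0 : 0 < u := Real.sqrt_pos.2 ht₀
  -- Threshold between the regimes: below it the chart estimates at `x` apply to radii `Rk * h` and
  -- `u * h`; above it `h` is bounded away from `0`.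
  set h₁ := r₀ / (Rk + u) with hh₁
  have hh₁0 : 0 < h₁ := by positivity
  have hsmall : ∀ h, 0 < h → h < h₁ → Rk * h < r₀ ∧ u * h < r₀ := by
    intro h h0 hlt
    rw [hh₁, lt_div_iff₀ (by positivity)] at hlt
    constructor <;> nlinarith
  obtain ⟨c₁, hc₁, hball⟩ := hi.exists_le_measure_ball hp hp_pos hP x
    (mul_pos hu0 hh₁0) (Rk * hmax)
  have : LocallyCompactSpace M := Manifold.locallyCompact_of_finiteDimensional I
  obtain ⟨C, hC⟩ := hi.eventually_edist_le hx
  obtain ⟨K, hK, hKmem⟩ := exists_isCompact_of_lt_kappa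
    (hasAlmostMinimizingCurves_of_isRiemannianManifold (I := I)) hic hC (R := Rk * hmax)
    -- The factor `2` in the bound on `hmax` supplies the strict inequality.
    (lt_of_lt_of_le ((ENNReal.ofReal_lt_ofReal_iff (by positivity)).2
      (by nlinarith [mul_pos hRk hmax0])) hmax_le)
  obtain ⟨Bf, hBf⟩ := hK.exists_bound_of_continuousOn hfc.continuousOn
  have hdist0 : ∀ y : M, y ∈ K → |f x - f y| ≤ |f x| + |Bf| := fun y hy =>
    (abs_sub _ _).trans (add_le_add le_rfl ((hBf y hy).trans (le_abs_self _)))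
  have hW0 : ∀ h, 0 < h → ∀ y z : M, 0 ≤ scaledKernel k m h (‖i y - i z‖ ^ 2) :=
    fun h h0 y z => scaledKernel_nonneg hk m h0 (by positivity)
  have hWB : ∀ h, 0 < h → ∀ y z : M, scaledKernel k m h (‖i y - i z‖ ^ 2) ≤ B / h ^ m := by
    intro h h0 y z
    rw [scaledKernel, one_div_mul_eq_div]
    gcongr
    exact hkB _ (by positivity)
  have hWsupp : ∀ h, 0 < h → ∀ y z : M, Rk * h < ‖i y - i z‖ →
      scaledKernel k m h (‖i y - i z‖ ^ 2) = 0 := by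
    intro h h0 y z hlt
    rw [scaledKernel, hsupp, mul_zero]
    rw [lt_div_iff₀ (by positivity), ← mul_pow]
    gcongr
  have hupper : ∀ h, 0 < h → ∀ y, ∫ z, scaledKernel k m h (‖i y - i z‖ ^ 2) ∂P ≤
      B / h ^ m * P.real {z | ‖i y - i z‖ ≤ Rk * h} := by
    intro h h0 y
    refine integral_le_of_le_indicator
      (isClosed_le (by fun_prop) continuous_const).measurableSet (fun z => ?_) (hW0 h h0 y)
    by_cases hz : ‖i y - i z‖ ≤ Rk * h
    · rw [indicator_of_mem (by exact hz)]; exact hWB h h0 y z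
    · rw [indicator_of_notMem (by exact hz), hWsupp h h0 y z (not_le.1 hz)]
  have hlower : ∀ h, 0 < h → ∀ y, k t₀ / h ^ m * P.real {z | ‖i y - i z‖ < u * h} ≤
      ∫ z, scaledKernel k m h (‖i y - i z‖ ^ 2) ∂P := by
    intro h h0 y
    -- Monotonicity gives `k ≥ k t₀` on `(0, t₀]` only, so the centre, a null set, is removed.
    have hae : P.real {z | ‖i y - i z‖ < u * h} = P.real ({z | ‖i y - i z‖ < u * h} \ {y}) := by
      rw [measureReal_def, measureReal_def,
        measure_sdiff_null (hP.measure_singleton_eq_zero hm y)]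
    rw [hae]
    refine le_integral_of_indicator_le (integrable_of_measurable_of_abs_le
      (measurable_scaledKernel hk hic m h).of_uncurry_left (b := B / h ^ m) fun z => by
        rw [abs_of_nonneg (hW0 h h0 y z)]; exact hWB h h0 y z)
      ((isOpen_lt (by fun_prop) continuous_const).measurableSet.diff (measurableSet_singleton y))
      fun z => ?_
    by_cases hz : z ∈ {z | ‖i y - i z‖ < u * h} \ {y}
    · rw [indicator_of_mem hz, scaledKernel, one_div_mul_eq_div]
      have h1 : ‖i y - i z‖ < u * h := hz.1
      have h2 : 0 < ‖i y - i z‖ := by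
        rw [norm_pos_iff, sub_ne_zero]
        exact fun h => hz.2 (hi.isEmbedding.injective h).symm
      have h3 : 0 < ‖i y - i z‖ ^ 2 / h ^ 2 := by positivity
      gcongr
      refine hk.antitoneOn h3 ht₀ ?_
      rw [div_le_iff₀ (by positivity), ← Real.sq_sqrt ht₀.le, ← hu, ← mul_pow]
      gcongr
    · rw [indicator_of_notMem hz]; exact hW0 h h0 y z
  -- In each `min` or `max`, the first entry serves `h < h₁` and the second `h₁ ≤ h < hmax`.
  refine ⟨B, hB, min (k t₀ * c₀ * u ^ m) (k t₀ / hmax ^ m * c₁),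
    max (B * D₀ * Rk ^ m) (B / h₁ ^ m), max (G₀ * Rk) ((|f x| + |Bf|) / h₁),
    lt_max_of_lt_left (by positivity), fun h h0 hlt => ⟨?_, fun y hy => ?_⟩⟩
  · have hhmax : h ^ m ≤ hmax ^ m := by gcongr
    refine ⟨measurable_scaledKernel hk hic m h, hW0 h h0, hWB h h0, fun y => ?_, by positivity,
      (isClosed_le (by fun_prop) continuous_const).measurableSet, ?_, fun z hz => ?_, ?_,
      fun y hy => ?_, fun y hy => ?_⟩
    · simp [scaledKernel, hk.zero]
    · simp only [mem_ofPred_eq, sub_self, norm_zero]; positivity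
    · exact hWsupp h h0 x z (not_le.1 hz)
    · exact lt_min (by positivity) (by positivity)
    · have hy' : ‖i x - i y‖ ≤ Rk * h := hy
      refine le_trans ?_ (hlower h h0 y)
      rcases lt_or_ge h h₁ with hh | hh
      · obtain ⟨h1, h2⟩ := hsmall h h0 hh
        have h3 := ((hloc y (hy'.trans_lt h1)).2 (u * h) (by positivity) h2).1
        rw [← ofReal_measureReal, ENNReal.ofReal_le_ofReal_iff measureReal_nonneg] at h3
        refine (min_le_left _ _).trans ?_
        calc k t₀ * c₀ * u ^ m = k t₀ / h ^ m * (c₀ * (u * h) ^ m) := by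
              rw [mul_pow]; field_simp
          _ ≤ _ := by gcongr
      · have h3 : ENNReal.ofReal c₁ ≤ P {z | ‖i y - i z‖ < u * h} :=
          (hball y (hy'.trans (by gcongr))).trans (measure_mono fun z hz =>
            lt_of_lt_of_le hz (mul_le_mul_of_nonneg_left hh hu0.le))
        rw [← ofReal_measureReal, ENNReal.ofReal_le_ofReal_iff measureReal_nonneg] at h3
        refine (min_le_right _ _).trans ?_
        gcongr
    · have hy' : ‖i x - i y‖ ≤ Rk * h := hy
      refine (hupper h h0 y).trans ?_
      rcases lt_or_ge h h₁ with hh | hh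
      · obtain ⟨h1, h2⟩ := hsmall h h0 hh
        have h3 := ((hloc y (hy'.trans_lt h1)).2 (Rk * h) (by positivity) h1).2
        rw [← ofReal_measureReal, ENNReal.ofReal_le_ofReal_iff (by positivity)] at h3
        refine le_trans ?_ (le_max_left _ _)
        calc _ ≤ B / h ^ m * (D₀ * (Rk * h) ^ m) := by gcongr
          _ = B * D₀ * Rk ^ m := by rw [mul_pow]; field_simp
      · refine le_trans ?_ (le_max_right _ _)
        calc _ ≤ B / h ^ m * 1 := by
              gcongr
              exact measureReal_le_one
          _ ≤ B / h₁ ^ m := by rw [mul_one]; gcongr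
  · rcases lt_or_ge h h₁ with hh | hh
    · obtain ⟨h1, h2⟩ := hsmall h h0 hh
      refine ((hloc y (hy.trans_lt h1)).1).trans ?_
      calc _ ≤ G₀ * (Rk * h) := by gcongr
        _ = G₀ * Rk * h := by ring
        _ ≤ _ := by gcongr; exact le_max_left _ _
    · refine (hdist0 y (hKmem y (hy.trans (by gcongr)))).trans ?_
      calc |f x| + |Bf| = (|f x| + |Bf|) / h₁ * h₁ := by field_simp
        _ ≤ (|f x| + |Bf|) / h₁ * h := by gcongr
        _ ≤ _ := by gcongr; exact le_max_right _ _

end ScaledKernel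

/-! ### From the product measure to the sample, and the theorem. -/

section Transfer

/-- Independence makes the joint law a product. Since `Q` is not assumed measurable, the complement
is handled by subadditivity. -/
theorem measure_sample_ge {M : Type*} [MeasurableSpace M] {P : Measure M} [IsProbabilityMeasure P]
    {S : Type*} [MeasurableSpace S] {μ : Measure S} [IsProbabilityMeasure μ] {n : ℕ}
    {X : Fin n → S → M} (hX : ∀ j, Measurable (X j)) (hlaw : ∀ j, μ.map (X j) = P)
    (hind : iIndepFun X μ) {Q : (Fin n → M) → Prop} {a : ℝ} (ha : 0 ≤ a)
    (hQ : (Measure.pi fun _ : Fin n => P) {x | ¬ Q x} ≤ ENNReal.ofReal a) :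
    ENNReal.ofReal (1 - a) ≤ μ {s | Q fun j => X j s} := by
  have hmap : μ.map (fun s j => X j s) = Measure.pi fun _ : Fin n => P := by
    rw [(iIndepFun_iff_map_fun_eq_pi_map fun j => (hX j).aemeasurable).1 hind]
    simp_rw [hlaw]
  have hbad : μ {s | ¬ Q fun j => X j s} ≤ ENNReal.ofReal a := by
    refine le_trans ?_ hQ
    rw [← hmap]
    exact Measure.le_map_apply (measurable_pi_lambda _ hX).aemeasurable {x | ¬ Q x}
  have hone : 1 ≤ μ {s | Q fun j => X j s} + ENNReal.ofReal a := by
    calc (1 : ℝ≥0∞) = μ univ := measure_univ.symm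
      _ ≤ μ ({s | Q fun j => X j s} ∪ {s | ¬ Q fun j => X j s}) :=
        measure_mono fun s _ => em _
      _ ≤ _ := (measure_union_le _ _).trans (by gcongr)
  rw [ENNReal.ofReal_sub _ ha, ENNReal.ofReal_one]
  exact tsub_le_iff_right.2 hone

end Transfer

/-- Since `8 / e > 1`, the probability bound is void when `n h^m ε² ≤ C`. -/
theorem one_sub_mul_exp_nonpos {C n q : ℝ} (hC : 8 ≤ C) (hn : 1 ≤ n) (hq : q ≤ C) :
    1 - C * n * Real.exp (-q / C) ≤ 0 := by
  have h1 : Real.exp (-1) ≤ Real.exp (-q / C) := by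
    refine Real.exp_le_exp.2 ?_
    rw [le_div_iff₀ (by linarith)]
    linarith
  have h2 := Real.exp_neg_one_gt_d9
  have h3 : 8 ≤ C * n := by nlinarith
  nlinarith

theorem scaledKernel_eq_zero {k : ℝ → ℝ} (hk : IsAdmissibleKernel k)
    (h0 : ¬ ∃ t, 0 < t ∧ 0 < k t) (m : ℕ) (h : ℝ) {t : ℝ} (ht : 0 ≤ t) :
    scaledKernel k m h t = 0 := by
  have h1 : ∀ t, 0 ≤ t → k t = 0 := fun t ht => by
    rcases ht.eq_or_lt with rfl | ht
    · exact hk.zero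
    · by_contra hne
      exact h0 ⟨t, ht, lt_of_le_of_ne (hk.nonneg t ht.le) (Ne.symm hne)⟩
  rw [scaledKernel, h1 _ (by positivity), mul_zero]

theorem mainTheorem7 {m d : ℕ} (hm : 0 < m)
    {H : Type*} [TopologicalSpace H]
    (I : ModelWithCorners ℝ (EuclideanSpace ℝ (Fin m)) H)
    {M : Type*} [EMetricSpace M] [ChartedSpace H M] [IsManifold I ∞ M]
    [RiemannianBundle (fun x : M => TangentSpace I x)]
    [IsContMDiffRiemannianBundle I ∞ (EuclideanSpace ℝ (Fin m))
      (fun x : M => TangentSpace I x)]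
    [IsRiemannianManifold I M] [CompleteSpace M]
    [MeasurableSpace M] [BorelSpace M]
    (i : M → EuclideanSpace ℝ (Fin d)) (hi : IsIsometricEmbedding I i)
    (hκ : 0 < kappa i)
    (k : ℝ → ℝ) (hk : IsAdmissibleKernel k)
    (Rk : ℝ) (hRk : 0 < Rk) (hsupp : ∀ t, Rk ^ 2 < t → k t = 0)
    (P : Measure M) [IsProbabilityMeasure P]
    (p : M → ℝ) (hp : ContMDiff I 𝓘(ℝ, ℝ) 3 p) (hp_pos : ∀ y ∈ I.interior M, 0 < p y)
    (hP : HasVolumeDensity I i P p)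
    (lam : ℝ) (x : M) (hx : x ∈ I.interior M)
    (f : M → ℝ) (hf : ContMDiff I 𝓘(ℝ, ℝ) 3 f)
    (hmax : ℝ) (hmax_le : ENNReal.ofReal (2 * Rk * hmax) ≤ kappa i) :
    ∃ C : ℝ, 0 < C ∧
      ∀ (n : ℕ) (h ε : ℝ), 0 < n → 0 < h → h < hmax →
        2 * kernelSupNorm k / (n * h ^ m) < ε → ε < 1 / C →
        ∀ (S : Type*) [MeasurableSpace S] (μ : Measure S) [IsProbabilityMeasure μ]
          (X : Fin n → S → M), (∀ j, Measurable (X j)) → (∀ j, μ.map (X j) = P) →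
          iIndepFun X μ →
          ENNReal.ofReal (1 - C * n * Real.exp (-(n * h ^ m * ε ^ 2) / C)) ≤
            μ {s |
              |empAverage i k m lam h (fun j => X j s) (fun y => f x - f y) x
                  - contAverage i k m P lam h (fun y => f x - f y) x| ≤ ε * h ∧
              |empReweightedDegree i k m lam h (fun j => X j s) x
                  - contReweightedDegree i k m P lam h x| ≤ ε} := by
  rcases le_or_gt hmax 0 with hmax0 | hmax0
  · exact ⟨1, one_pos, fun n h ε _ h1 h2 => absurd (h1.trans h2) (not_lt.2 hmax0)⟩
  have hnorm : 0 ≤ kernelSupNorm k := Real.iSup_nonneg fun t => abs_nonneg _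
  -- If `k` vanishes on `[0, ∞)` there is no lower bound on the degrees, but both sides of each
  -- estimate are zero.
  by_cases hk0 : ∃ t, 0 < t ∧ 0 < k t
  swap
  · refine ⟨1, one_pos, fun n h ε hn hh _ hε _ S _ μ _ X _ _ _ => ?_⟩
    have hε0 : 0 < ε := lt_of_le_of_lt (by positivity) hε
    have hz : ∀ y z : M, scaledKernel k m h (‖i y - i z‖ ^ 2) = 0 := fun y z =>
      scaledKernel_eq_zero hk hk0 m h (by positivity)
    have huniv : {s | |empAverage i k m lam h (fun j => X j s) (fun y => f x - f y) x
          - contAverage i k m P lam h (fun y => f x - f y) x| ≤ ε * h ∧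
        |empReweightedDegree i k m lam h (fun j => X j s) x
          - contReweightedDegree i k m P lam h x| ≤ ε} = univ := by
      refine eq_univ_of_forall fun s => ?_
      simp only [mem_ofPred_eq, empAverage, contAverage, empReweightedDegree, contReweightedDegree,
        empReweightedKernel, reweightedKernel, hz, zero_div, zero_mul, Finset.sum_const_zero,
        mul_zero, integral_zero, sub_self, abs_zero]
      exact ⟨by positivity, hε0.le⟩
    rw [huniv, measure_univ]
    refine ENNReal.ofReal_le_one.2 ?_
    have : 0 ≤ 1 * (n : ℝ) * Real.exp (-(n * h ^ m * ε ^ 2) / 1) := by positivity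
    linarith
  obtain ⟨t₀, ht₀, hkt₀⟩ := hk0
  obtain ⟨B, hB, c, D, G, hG, hloc⟩ := hi.exists_isLocalKernel hm hk hRk hsupp hp hp_pos hP hx hf
    hmax0 hmax_le ht₀ hkt₀
  have hc : 0 < c := (hloc (hmax / 2) (by linarith) (by linarith)).1.c_pos
  have hcD : c ≤ D := (hloc (hmax / 2) (by linarith) (by linarith)).1.c_le
  have hD : 0 < D := hc.trans_le hcD
  obtain ⟨U, hU, Λ, hΛ, hUΛ⟩ := exists_rpow_bounds lam (a := c ^ 2 / 4) (b := 4 * D ^ 2)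
    (by positivity)
  have hU0 : 0 < U := by linarith
  set A := 1 + 8 * D ^ 2 * Λ with hA
  have hA1 : 1 ≤ A := by
    have : 0 ≤ 8 * D ^ 2 * Λ := by positivity
    linarith
  -- Dominates both error factors: `A` for the degree and `G * A` for the average.
  set C₁ := A * (1 + G) with hC₁
  have hC₁A : C₁ = A + G * A := by rw [hC₁]; ring
  have hGA : 0 < G * A := mul_pos hG (by linarith)
  have hC₁1 : 1 ≤ C₁ := by linarith
  have hC₁0 : 0 < C₁ := by linarith
  -- In order, the summands serve the void regime, `4 * δ ≤ c`, `D ≤ n * δ`, and the comparison of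
  -- exponents.
  set C := 8 + 4 / c + D * C₁ * hmax ^ m + 4 * B * D * C₁ ^ 2 * U ^ 2 with hC
  have e1 : 0 < 4 / c := by positivity
  have e2 : 0 < D * C₁ * hmax ^ m := by positivity
  have e3 : 0 < 4 * B * D * C₁ ^ 2 * U ^ 2 := by positivity
  have hC8 : 8 ≤ C := by linarith
  have hCc : 4 / c ≤ C := by linarith
  have hCD : D * C₁ * hmax ^ m ≤ C := by linarith
  have hCB : 4 * B * D * C₁ ^ 2 * U ^ 2 ≤ C := by linarith
  have hC0 : 0 < C := by linarith
  clear_value C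
  refine ⟨C, hC0, fun n h ε hn hh hlt hε hεC S _ μ _ X hXm hlaw hind => ?_⟩
  have hε0 : 0 < ε := lt_of_le_of_lt (by positivity) hε
  have hn1 : (1 : ℝ) ≤ n := by exact_mod_cast hn
  rcases le_or_gt (n * h ^ m * ε ^ 2) C with hq | hq
  · rw [ENNReal.ofReal_of_nonpos (one_sub_mul_exp_nonpos hC8 hn1 hq)]
    exact zero_le
  obtain ⟨hW, hGh⟩ := hloc h hh hlt
  set δ := ε / C₁ with hδ
  have hδ0 : 0 < δ := by positivity
  have hεC' : C * ε < 1 := by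
    rw [lt_div_iff₀ hC0] at hεC
    linarith
  have hε1 : ε ≤ 1 := by
    have h1 : 8 * ε ≤ C * ε := mul_le_mul_of_nonneg_right hC8 hε0.le
    linarith only [h1, hεC', hε0]
  have hδc : 4 * δ ≤ c := by
    have h1 : δ ≤ ε := div_le_self hε0.le hC₁1
    have h2 : 4 / c * ε ≤ 1 := le_trans (by gcongr) hεC'.le
    rw [div_mul_eq_mul_div, div_le_one hc] at h2
    linarith
  have hDδ : D ≤ n * δ := by
    rw [hδ, mul_div_assoc', le_div_iff₀ hC₁0]
    -- Outside the void regime `n h^m ε² > C`; with `h < hmax` and `ε ≤ 1` this makes `n * ε` large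
    -- enough to absorb the diagonal term.
    have h1 : D * C₁ * hmax ^ m < n * ε * hmax ^ m := by
      calc D * C₁ * hmax ^ m ≤ C := hCD
        _ < n * h ^ m * ε ^ 2 := hq
        _ ≤ n * hmax ^ m * (ε * 1) := by
          rw [sq]; gcongr
        _ = _ := by ring
    exact (lt_of_mul_lt_mul_right h1 (by positivity)).le
  obtain ⟨N, rfl⟩ : ∃ N, n = N + 1 := ⟨n - 1, by omega⟩
  have hconc := hW.measure_pi_not_le hU hΛ hUΛ hδ0 hδc hDδ (g := fun y => f x - f y)
    (measurable_const.sub hf.continuous.measurable) (mul_pos hG hh) hGh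
  refine measure_sample_ge hXm hlaw hind (Q := fun X =>
    |empAverage i k m lam h X (fun y => f x - f y) x
        - contAverage i k m P lam h (fun y => f x - f y) x| ≤ ε * h ∧
      |empReweightedDegree i k m lam h X x - contReweightedDegree i k m P lam h x| ≤ ε)
    (by positivity) ?_
  refine (measure_mono fun X hX => ?_).trans (hconc.trans (ENNReal.ofReal_le_ofReal ?_))
  · refine fun hgood => hX ⟨hgood.1.trans ?_, ?_⟩
    · rw [← hA, hδ]
      have h1 : G * A ≤ C₁ := by linarith only [hC₁A, hA1]
      calc G * h * (A * (ε / C₁)) = G * A / C₁ * (ε * h) := by ring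
        _ ≤ 1 * (ε * h) := by
          gcongr
          exact (div_le_one hC₁0).2 h1
        _ = _ := one_mul _
    · have h1 : A * δ ≤ ε := by
        rw [hδ, mul_div_assoc', div_le_iff₀ hC₁0, mul_comm]
        exact mul_le_mul_of_nonneg_left (by linarith only [hC₁A, hGA]) hε0.le
      have h2 := hgood.2.trans h1
      simp only [empReweightedDegree, contReweightedDegree, contAverage, mul_one]
      exact h2
  · have h1 : ((N + 1 : ℕ) : ℝ) * h ^ m * ε ^ 2 / C ≤
        (N + 1 : ℕ) * (δ / U) ^ 2 / (4 * (B / h ^ m) * D) := by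
      have h2 : ((N + 1 : ℕ) : ℝ) * (δ / U) ^ 2 / (4 * (B / h ^ m) * D) =
          (N + 1 : ℕ) * h ^ m * ε ^ 2 / (4 * B * D * C₁ ^ 2 * U ^ 2) := by
        rw [hδ]; field_simp
      rw [h2]
      gcongr
    have h3 : Real.exp (-((N + 1 : ℕ) * (δ / U) ^ 2 / (4 * (B / h ^ m) * D))) ≤
        Real.exp (-((N + 1 : ℕ) * h ^ m * ε ^ 2) / C) := by
      rw [neg_div]
      exact Real.exp_le_exp.2 (neg_le_neg h1)
    gcongr
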